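/- Let $\mathcal{H}$ be intensional Martin-Löf type theory with $\Sigma$-types, $\Pi$-types, identity types $\mathsf{Id}$, one type universe $\mathsf{U}$ (à la Russell) closed under $\Sigma$, $\Pi$ and $\mathsf{Id}$, the judgemental $\eta$-rule for $\Pi$-types, and function extensionality (pointwise propositionally equal elements of a $\Pi$-type are propositionally equal). Write $$\mathsf{iscontr}(X) = (\Sigma x : X)(\Pi y : X)\,\mathsf{Id}_X(x,y), \qquad \mathsf{isequiv}(f) = (\Pi y : Y)\,\mathsf{iscontr}\big((\Sigma x : X)\,\mathsf{Id}_Y(fx,y)\big) \text{ for } f : X \to Y,$$ and $\mathsf{Equiv}(X,Y) = (\Sigma f : X \to Y)\,\mathsf{isequiv}(f)$. The univalence axiom asserts that for all $X, Y : \mathsf{U}$ the canonical function $\mathsf{Id}_{\mathsf{U}}(X,Y) \to \mathsf{Equiv}(X,Y)$, defined by $\mathsf{Id}$-elimination so as to take $\mathsf{refl}(X)$ to the identity equivalence, is an equivalence. Let $A : \mathsf{U}$ and $B : A \to \mathsf{U}$. For $C : \mathsf{U}$ put $PC = (\Sigma x : A)(B(x) \to C)$, and for $f : C \to D$ let $Pf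 : PC \to PD$ be defined by $\Sigma$-elimination so that $(Pf)(x,u) = (x, f \circ u)$. Let $\mathsf{Alg} = (\Sigma C : \mathsf{U})(PC \to C)$ be the type of $P$-algebras. For $P$-algebras $C = (C,\sup_C)$ and $D = (D,\sup_D)$ let $$\mathsf{Alg}(C,D) = (\Sigma f : C \to D)\,\mathsf{Id}_{PC \to D}(f \circ \sup\nolimits_C,\ \sup\nolimits_D \circ Pf)$$ be the type of $P$-algebra morphisms, and let $\mathsf{ishinit}(C) = (\Pi D : \mathsf{Alg})\,\mathsf{iscontr}(\mathsf{Alg}(C,D))$ be the type expressing that $C$ is homotopy-initial. Then, in $\mathcal{H}$ and assuming the univalence axiom, homotopy-initial $P$-algebras are unique up to a contractible type of paths; that is, in every context in which $A : \mathsf{U}$ and $B : A \to \mathsf{U}$ are given and the univalence axiom is inhabited, the type $$(\Pi C : \mathsf{Alg})(\Pi D : \mathsf{Alg})\,\big(\mathsf{ishinit}(C) \times \mathsf{ishinit}(D) \to \mathsf{iscontr}(\mathsf{Id}_{\mathsf{Alg}}(C,D))\big)$$ is inhabited. -/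

import Mathlib

/-!
# The type theory `H`, and algebras for a polynomial functor in it

`H` is intensional Martin-Löf type theory with `Σ`-types, `Π`-types, identity types, one universe `U`
(à la Russell), the judgemental `η`-rule for `Π`-types and the function extensionality axiom. It is
given here by raw syntax with de Bruijn indices and an inductively defined derivability relation.
-/

namespace HTT

/-! ### Raw syntax -/

/-- Raw expressions (types and terms share one syntactic class since `U` is à la Russell).
The eliminators carry their motive and pairs carry the family of the `Σ`-type they belong to, so
that an expression determines its type up to judgemental equality.
Variables bound in an argument are the lowest indices, the last bound variable being `0`. -/
inductive Tm : Type where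
  /-- a variable -/
  | var (i : ℕ) : Tm
  /-- the type universe `U` -/
  | U : Tm
  /-- `(Π x : A) B(x)`; `B` binds `x` -/
  | pi (A B : Tm) : Tm
  /-- `(Σ x : A) B(x)`; `B` binds `x` -/
  | sigma (A B : Tm) : Tm
  /-- `Id_A(a, b)` -/
  | id (A a b : Tm) : Tm
  /-- `(λ x : A) b(x)`; `b` binds `x` -/
  | lam (A b : Tm) : Tm
  /-- `app(f, a)` -/
  | app (f a : Tm) : Tm
  /-- `pair(a, b)` as an element of `(Σ x : A) B(x)`; `B` binds `x` -/
  | pair (B a b : Tm) : Tm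
  /-- `split(c, e)` with motive `E`; `E` binds `z : (Σ x : A) B(x)`, and `e` binds `x`, `y` -/
  | split (E e c : Tm) : Tm
  /-- `refl(a)` -/
  | refl (a : Tm) : Tm
  /-- `J(a, b, p, e)` with motive `E`; `E` binds `x`, `y`, `u : Id_A(x, y)`, and `e` binds `x` -/
  | J (E e a b p : Tm) : Tm
  /-- `funext(f, g, α)`; `α` binds `x` -/
  | funext (f g α : Tm) : Tm

namespace Tm

/-- A renaming pushed under one binder. -/
def upr (ρ : ℕ → ℕ) : ℕ → ℕ
  | 0 => 0
  | i + 1 => ρ i + 1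

/-- Renaming of the free variables. -/
def ren : (ℕ → ℕ) → Tm → Tm
  | ρ, var i => var (ρ i)
  | _, U => U
  | ρ, pi A B => pi (ren ρ A) (ren (upr ρ) B)
  | ρ, sigma A B => sigma (ren ρ A) (ren (upr ρ) B)
  | ρ, id A a b => id (ren ρ A) (ren ρ a) (ren ρ b)
  | ρ, lam A b => lam (ren ρ A) (ren (upr ρ) b)
  | ρ, app f a => app (ren ρ f) (ren ρ a)
  | ρ, pair B a b => pair (ren (upr ρ) B) (ren ρ a) (ren ρ b)
  | ρ, split E e c => split (ren (upr ρ) E) (ren (upr (upr ρ)) e) (ren ρ c)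
  | ρ, refl a => refl (ren ρ a)
  | ρ, J E e a b p =>
      J (ren (upr (upr (upr ρ))) E) (ren (upr ρ) e) (ren ρ a) (ren ρ b) (ren ρ p)
  | ρ, funext f g α => funext (ren ρ f) (ren ρ g) (ren (upr ρ) α)

/-- Weakening by `k` variables. -/
def wkn (k : ℕ) (t : Tm) : Tm := t.ren (fun i => i + k)

/-- Weakening by one variable. -/
def wk (t : Tm) : Tm := t.wkn 1

/-- A substitution pushed under one binder. -/
def up (σ : ℕ → Tm) : ℕ → Tm
  | 0 => var 0
  | i + 1 => (σ i).wk

/-- Simultaneous capture-avoiding substitution. -/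
def sub : (ℕ → Tm) → Tm → Tm
  | σ, var i => σ i
  | _, U => U
  | σ, pi A B => pi (sub σ A) (sub (up σ) B)
  | σ, sigma A B => sigma (sub σ A) (sub (up σ) B)
  | σ, id A a b => id (sub σ A) (sub σ a) (sub σ b)
  | σ, lam A b => lam (sub σ A) (sub (up σ) b)
  | σ, app f a => app (sub σ f) (sub σ a)
  | σ, pair B a b => pair (sub (up σ) B) (sub σ a) (sub σ b)
  | σ, split E e c => split (sub (up σ) E) (sub (up (up σ)) e) (sub σ c)
  | σ, refl a => refl (sub σ a)
  | σ, J E e a b p =>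
      J (sub (up (up (up σ))) E) (sub (up σ) e) (sub σ a) (sub σ b) (sub σ p)
  | σ, funext f g α => funext (sub σ f) (sub σ g) (sub (up σ) α)

/-- The substitution `0 ↦ a`, `i + 1 ↦ σ i`. -/
def scons (a : Tm) (σ : ℕ → Tm) : ℕ → Tm
  | 0 => a
  | i + 1 => σ i

/-- `t(a)`: the last variable of `t` replaced by `a`. -/
def inst (t a : Tm) : Tm := t.sub (scons a var)

/-- `t(a, b)`: the last two variables of `t` replaced by `a`, `b`. -/
def inst2 (t a b : Tm) : Tm := t.sub (scons b (scons a var))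

/-- `t(a, b, c)`: the last three variables of `t` replaced by `a`, `b`, `c`. -/
def inst3 (t a b c : Tm) : Tm := t.sub (scons c (scons b (scons a var)))

/-- For `E` over `z : (Σ x : A) B(x)`, the type `E(pair(x, y))` over `x : A`, `y : B(x)`. -/
def splitCase (B E : Tm) : Tm :=
  E.sub (scons (pair (B.ren (upr (fun i => i + 2))) (var 1) (var 0)) (fun i => var (i + 2)))

/-- For `E` over `x y : A`, `u : Id_A(x, y)`, the type `E(x, x, refl(x))` over `x : A`. -/
def JCase (E : Tm) : Tm :=
  E.sub (scons (refl (var 0)) (scons (var 0) (scons (var 0) (fun i => var (i + 1)))))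

end Tm

open Tm

/-! ### Judgements and rules -/

/-- Contexts; the most recently declared variable comes first. -/
abbrev Ctx : Type := List Tm

/-- `Lookup Γ i A`: the variable `i` is declared in `Γ`, with type `A` (weakened to `Γ`). -/
inductive Lookup : Ctx → ℕ → Tm → Prop
  | here {Γ : Ctx} {A : Tm} : Lookup (A :: Γ) 0 A.wk
  | there {Γ : Ctx} {A B : Tm} {i : ℕ} : Lookup Γ i A → Lookup (B :: Γ) (i + 1) A.wk

/-- The forms of judgement, besides well-formedness of the context. -/
inductive Judgement : Type where
  /-- the context is well formed -/
  | ctx : Judgement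
  /-- `A : type` -/
  | isType (A : Tm) : Judgement
  /-- `A = B : type` -/
  | eqType (A B : Tm) : Judgement
  /-- `a : A` -/
  | hasType (a A : Tm) : Judgement
  /-- `a = b : A` -/
  | eqTerm (a b A : Tm) : Judgement

namespace Judgement

/-- Substitution in a judgement. -/
def sub (σ : ℕ → Tm) : Judgement → Judgement
  | ctx => ctx
  | isType A => isType (A.sub σ)
  | eqType A B => eqType (A.sub σ) (B.sub σ)
  | hasType a A => hasType (a.sub σ) (A.sub σ)
  | eqTerm a b A => eqTerm (a.sub σ) (b.sub σ) (A.sub σ)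

/-- Weakening of a judgement by one variable. -/
def wk : Judgement → Judgement
  | ctx => ctx
  | isType A => isType A.wk
  | eqType A B => eqType A.wk B.wk
  | hasType a A => hasType a.wk A.wk
  | eqTerm a b A => eqTerm a.wk b.wk A.wk

end Judgement

open Judgement

/-- `Der Γ 𝓙`: the judgement `Γ ⊢ 𝓙` is derivable in the type theory `H`. -/
inductive Der : Ctx → Judgement → Prop
  /- contexts, variables, weakening and substitution -/
  | ctx_nil : Der [] ctx
  | ctx_cons {Γ : Ctx} {A : Tm} : Der Γ (isType A) → Der (A :: Γ) ctx
  | var {Γ : Ctx} {i : ℕ} {A : Tm} : Der Γ ctx → Lookup Γ i A → Der Γ (hasType (var i) A)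
  | weaken {Γ : Ctx} {A : Tm} {𝓙 : Judgement} :
      Der Γ (isType A) → Der Γ 𝓙 → Der (A :: Γ) 𝓙.wk
  | subst {Γ Δ : Ctx} {σ : ℕ → Tm} {𝓙 : Judgement} :
      Der Γ ctx → (∀ i A, Lookup Δ i A → Der Γ (hasType (σ i) (A.sub σ))) → Der Δ 𝓙 →
      Der Γ (𝓙.sub σ)
  | subst_eqType {Γ : Ctx} {A B a a' : Tm} :
      Der (A :: Γ) (isType B) → Der Γ (eqTerm a a' A) → Der Γ (eqType (B.inst a) (B.inst a'))
  | subst_eqTerm {Γ : Ctx} {A B b a a' : Tm} :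
      Der (A :: Γ) (hasType b B) → Der Γ (eqTerm a a' A) →
      Der Γ (eqTerm (b.inst a) (b.inst a') (B.inst a))
  /- judgemental equality is an equivalence relation, and conversion -/
  | eqType_refl {Γ : Ctx} {A : Tm} : Der Γ (isType A) → Der Γ (eqType A A)
  | eqType_symm {Γ : Ctx} {A B : Tm} : Der Γ (eqType A B) → Der Γ (eqType B A)
  | eqType_trans {Γ : Ctx} {A B C : Tm} :
      Der Γ (eqType A B) → Der Γ (eqType B C) → Der Γ (eqType A C)
  | eqTerm_refl {Γ : Ctx} {a A : Tm} : Der Γ (hasType a A) → Der Γ (eqTerm a a A)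
  | eqTerm_symm {Γ : Ctx} {a b A : Tm} : Der Γ (eqTerm a b A) → Der Γ (eqTerm b a A)
  | eqTerm_trans {Γ : Ctx} {a b c A : Tm} :
      Der Γ (eqTerm a b A) → Der Γ (eqTerm b c A) → Der Γ (eqTerm a c A)
  | conv {Γ : Ctx} {a A B : Tm} :
      Der Γ (hasType a A) → Der Γ (eqType A B) → Der Γ (hasType a B)
  | conv_eq {Γ : Ctx} {a b A B : Tm} :
      Der Γ (eqTerm a b A) → Der Γ (eqType A B) → Der Γ (eqTerm a b B)
  /- `Σ`-types -/
  | sigma_form {Γ : Ctx} {A B : Tm} : Der (A :: Γ) (isType B) → Der Γ (isType (sigma A B))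
  | pair_intro {Γ : Ctx} {A B a b : Tm} :
      Der (A :: Γ) (isType B) → Der Γ (hasType a A) → Der Γ (hasType b (B.inst a)) →
      Der Γ (hasType (pair B a b) (sigma A B))
  | split_elim {Γ : Ctx} {A B E e c : Tm} :
      Der (sigma A B :: Γ) (isType E) → Der (B :: A :: Γ) (hasType e (splitCase B E)) →
      Der Γ (hasType c (sigma A B)) →
      Der Γ (hasType (split E e c) (E.inst c))
  | split_comp {Γ : Ctx} {A B E e a b : Tm} :
      Der (sigma A B :: Γ) (isType E) → Der (B :: A :: Γ) (hasType e (splitCase B E)) →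
      Der Γ (hasType a A) → Der Γ (hasType b (B.inst a)) →
      Der Γ (eqTerm (split E e (pair B a b)) (e.inst2 a b) (E.inst (pair B a b)))
  /- `Π`-types, with the judgemental `η`-rule -/
  | pi_form {Γ : Ctx} {A B : Tm} : Der (A :: Γ) (isType B) → Der Γ (isType (pi A B))
  | lam_intro {Γ : Ctx} {A B b : Tm} :
      Der (A :: Γ) (hasType b B) → Der Γ (hasType (lam A b) (pi A B))
  | app_elim {Γ : Ctx} {A B f a : Tm} :
      Der Γ (hasType f (pi A B)) → Der Γ (hasType a A) → Der Γ (hasType (app f a) (B.inst a))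
  | app_comp {Γ : Ctx} {A B b a : Tm} :
      Der (A :: Γ) (hasType b B) → Der Γ (hasType a A) →
      Der Γ (eqTerm (app (lam A b) a) (b.inst a) (B.inst a))
  | pi_eta {Γ : Ctx} {A B f : Tm} :
      Der Γ (hasType f (pi A B)) →
      Der Γ (eqTerm f (lam A (app f.wk (.var 0))) (pi A B))
  /- identity types -/
  | id_form {Γ : Ctx} {A a b : Tm} :
      Der Γ (isType A) → Der Γ (hasType a A) → Der Γ (hasType b A) →
      Der Γ (isType (id A a b))
  | refl_intro {Γ : Ctx} {A a : Tm} :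
      Der Γ (hasType a A) → Der Γ (hasType (refl a) (id A a a))
  | J_elim {Γ : Ctx} {A E e a b p : Tm} :
      Der (id (A.wkn 2) (.var 1) (.var 0) :: A.wk :: A :: Γ) (isType E) →
      Der (A :: Γ) (hasType e (JCase E)) →
      Der Γ (hasType a A) → Der Γ (hasType b A) → Der Γ (hasType p (id A a b)) →
      Der Γ (hasType (J E e a b p) (E.inst3 a b p))
  | J_comp {Γ : Ctx} {A E e a : Tm} :
      Der (id (A.wkn 2) (.var 1) (.var 0) :: A.wk :: A :: Γ) (isType E) →
      Der (A :: Γ) (hasType e (JCase E)) → Der Γ (hasType a A) →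
      Der Γ (eqTerm (J E e a a (refl a)) (e.inst a) (E.inst3 a a (refl a)))
  /- the universe -/
  | U_form {Γ : Ctx} : Der Γ ctx → Der Γ (isType U)
  | U_type {Γ : Ctx} {A : Tm} : Der Γ (hasType A U) → Der Γ (isType A)
  | U_sigma {Γ : Ctx} {A B : Tm} :
      Der Γ (hasType A U) → Der (A :: Γ) (hasType B U) → Der Γ (hasType (sigma A B) U)
  | U_pi {Γ : Ctx} {A B : Tm} :
      Der Γ (hasType A U) → Der (A :: Γ) (hasType B U) → Der Γ (hasType (pi A B) U)
  | U_id {Γ : Ctx} {A a b : Tm} :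
      Der Γ (hasType A U) → Der Γ (hasType a A) → Der Γ (hasType b A) →
      Der Γ (hasType (id A a b) U)
  /- function extensionality -/
  | funext_ax {Γ : Ctx} {A B f g α : Tm} :
      Der Γ (hasType f (pi A B)) → Der Γ (hasType g (pi A B)) →
      Der (A :: Γ) (hasType α (id B (app f.wk (.var 0)) (app g.wk (.var 0)))) →
      Der Γ (hasType (funext f g α) (id (pi A B) f g))
  /- every constructor respects judgemental equality -/
  | sigma_cong {Γ : Ctx} {A A' B B' : Tm} :
      Der Γ (eqType A A') → Der (A :: Γ) (eqType B B') →
      Der Γ (eqType (sigma A B) (sigma A' B'))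
  | pair_cong {Γ : Ctx} {A B B' a a' b b' : Tm} :
      Der (A :: Γ) (eqType B B') → Der Γ (eqTerm a a' A) → Der Γ (eqTerm b b' (B.inst a)) →
      Der Γ (eqTerm (pair B a b) (pair B' a' b') (sigma A B))
  | split_cong {Γ : Ctx} {A B E E' e e' c c' : Tm} :
      Der (sigma A B :: Γ) (eqType E E') → Der (B :: A :: Γ) (eqTerm e e' (splitCase B E)) →
      Der Γ (eqTerm c c' (sigma A B)) →
      Der Γ (eqTerm (split E e c) (split E' e' c') (E.inst c))
  | pi_cong {Γ : Ctx} {A A' B B' : Tm} :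
      Der Γ (eqType A A') → Der (A :: Γ) (eqType B B') → Der Γ (eqType (pi A B) (pi A' B'))
  | lam_cong {Γ : Ctx} {A A' B b b' : Tm} :
      Der Γ (eqType A A') → Der (A :: Γ) (eqTerm b b' B) →
      Der Γ (eqTerm (lam A b) (lam A' b') (pi A B))
  | app_cong {Γ : Ctx} {A B f f' a a' : Tm} :
      Der Γ (eqTerm f f' (pi A B)) → Der Γ (eqTerm a a' A) →
      Der Γ (eqTerm (app f a) (app f' a') (B.inst a))
  | id_cong {Γ : Ctx} {A A' a a' b b' : Tm} :
      Der Γ (eqType A A') → Der Γ (eqTerm a a' A) → Der Γ (eqTerm b b' A) →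
      Der Γ (eqType (id A a b) (id A' a' b'))
  | refl_cong {Γ : Ctx} {A a a' : Tm} :
      Der Γ (eqTerm a a' A) → Der Γ (eqTerm (refl a) (refl a') (id A a a))
  | J_cong {Γ : Ctx} {A E E' e e' a a' b b' p p' : Tm} :
      Der (id (A.wkn 2) (.var 1) (.var 0) :: A.wk :: A :: Γ) (eqType E E') →
      Der (A :: Γ) (eqTerm e e' (JCase E)) →
      Der Γ (eqTerm a a' A) → Der Γ (eqTerm b b' A) → Der Γ (eqTerm p p' (id A a b)) →
      Der Γ (eqTerm (J E e a b p) (J E' e' a' b' p') (E.inst3 a b p))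
  | U_eqType {Γ : Ctx} {A B : Tm} : Der Γ (eqTerm A B U) → Der Γ (eqType A B)
  | U_sigma_cong {Γ : Ctx} {A A' B B' : Tm} :
      Der Γ (eqTerm A A' U) → Der (A :: Γ) (eqTerm B B' U) →
      Der Γ (eqTerm (sigma A B) (sigma A' B') U)
  | U_pi_cong {Γ : Ctx} {A A' B B' : Tm} :
      Der Γ (eqTerm A A' U) → Der (A :: Γ) (eqTerm B B' U) →
      Der Γ (eqTerm (pi A B) (pi A' B') U)
  | U_id_cong {Γ : Ctx} {A A' a a' b b' : Tm} :
      Der Γ (eqTerm A A' U) → Der Γ (eqTerm a a' A) → Der Γ (eqTerm b b' A) →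
      Der Γ (eqTerm (id A a b) (id A' a' b') U)
  | funext_cong {Γ : Ctx} {A B f f' g g' α α' : Tm} :
      Der Γ (eqTerm f f' (pi A B)) → Der Γ (eqTerm g g' (pi A B)) →
      Der (A :: Γ) (eqTerm α α' (id B (app f.wk (.var 0)) (app g.wk (.var 0)))) →
      Der Γ (eqTerm (funext f g α) (funext f' g' α') (id (pi A B) f g))

/-! ### Derived notions -/

namespace Tm

/-- `A → B` -/
def arr (A B : Tm) : Tm := pi A B.wk

/-- `A × B` -/
def prod (A B : Tm) : Tm := sigma A B.wk

/-- `π₁(c) : A`, for `c : (Σ x : A) B(x)`. -/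
def fst (A c : Tm) : Tm := split A.wk (var 1) c

/-- `π₂(c) : B(π₁(c))`, for `c : (Σ x : A) B(x)`. -/
def snd (A B c : Tm) : Tm :=
  split (B.sub (scons (fst A.wk (var 0)) (fun i => var (i + 1)))) (var 0) c

/-- `1_A : A → A` -/
def idfun (A : Tm) : Tm := lam A (var 0)

/-- `g ∘ f`, for a function `f` with domain `A`. -/
def comp (A g f : Tm) : Tm := lam A (app g.wk (app f.wk (var 0)))

/-- `iscontr(A) = (Σ x : A)(Π y : A) Id_A(x, y)` -/
def iscontr (A : Tm) : Tm := sigma A (pi A.wk (id (A.wkn 2) (var 1) (var 0)))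

/-- The family `x ↦ Id_B(f x, y)` over `x : A`. -/
def hfiberFam (B f y : Tm) : Tm := id B.wk (app f.wk (var 0)) y.wk

/-- `hfiber(f, y) = (Σ x : A) Id_B(f x, y)`, for `f : A → B` and `y : B`. -/
def hfiber (A B f y : Tm) : Tm := sigma A (hfiberFam B f y)

/-- `isequiv(f) = (Π y : B) iscontr(hfiber(f, y))`, for `f : A → B`. -/
def isequiv (A B f : Tm) : Tm := pi B (iscontr (hfiber A.wk B.wk f.wk (var 0)))

/-- `Equiv(A, B) = (Σ f : A → B) isequiv(f)` -/
def equiv (A B : Tm) : Tm := sigma (arr A B) (isequiv A.wk B.wk (var 0))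

/-- `pair(y, refl(y)) : hfiber(1_A, y)` -/
def idCenter (A y : Tm) : Tm := pair (hfiberFam A (idfun A) y) y (refl y)

/-- The proof of `iscontr(hfiber(1_A, y))` with centre `pair(y, refl(y))`, by `Σ`-elimination and
`Id`-elimination: for `w : hfiber(1_A, y)`, split `w` as `pair(x, p)`, and apply `J` to
`p : Id_A(x, y)` with the motive `Id(pair(y', refl(y')), pair(x', u))` over `x' y' : A`,
`u : Id_A(x', y')`. -/
def idContr (A y : Tm) : Tm :=
  pair
    (pi (hfiber A A (idfun A) y).wk (id ((hfiber A A (idfun A) y).wkn 2) (var 1) (var 0)))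
    (idCenter A y)
    (lam (hfiber A A (idfun A) y)
      (split
        (id ((hfiber A A (idfun A) y).wkn 2) ((idCenter A y).wkn 2) (var 0))
        (J
          (id (hfiber (A.wkn 6) (A.wkn 6) (idfun (A.wkn 6)) (var 1))
            (idCenter (A.wkn 6) (var 1))
            (pair (hfiberFam (A.wkn 6) (idfun (A.wkn 6)) (var 1)) (var 2) (var 0)))
          (refl (idCenter (A.wkn 4) (var 0)))
          (var 1) (y.wkn 3) (var 0))
        (var 0)))

/-- The proof of `isequiv(1_A)`. -/
def idIsEquiv (A : Tm) : Tm := lam A (idContr A.wk (var 0))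

/-- The identity equivalence `pair(1_A, _) : Equiv(A, A)`. -/
def idEquiv (A : Tm) : Tm := pair (isequiv A.wk A.wk (var 0)) (idfun A) (idIsEquiv A)

/-- The extension function `Id_U(X, Y) → Equiv(X, Y)` of the universe, defined by `Id`-elimination
so that it takes `refl(X)` to the identity equivalence. -/
def extU (X Y : Tm) : Tm :=
  lam (id U X Y) (J (equiv (var 2) (var 1)) (idEquiv (var 0)) X.wk Y.wk (var 0))

/-- The univalence axiom: `(Π X : U)(Π Y : U) isequiv(ext_{X,Y})`. -/
def univalence : Tm :=
  pi U (pi U (isequiv (id U (var 1) (var 0)) (equiv (var 1) (var 0)) (extU (var 1) (var 0))))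

/-! In the following, `A : U` and `B : A → U` are the parameters of the polynomial functor `P`. -/

/-- The family `x ↦ (B(x) → C)` over `x : A`. -/
def polyFam (B C : Tm) : Tm := arr (app B.wk (var 0)) C.wk

/-- `PC = (Σ x : A)(B(x) → C)` -/
def poly (A B C : Tm) : Tm := sigma A (polyFam B C)

/-- `Pf : PC → PD` for `f : C → D`, defined by `Σ`-elimination so that
`(Pf)(pair(x, u)) = pair(x, f ∘ u)`. -/
def polyMap (A B C D f : Tm) : Tm :=
  lam (poly A B C)
    (split ((poly A B D).wkn 2)
      (pair (polyFam (B.wkn 3) (D.wkn 3)) (var 1) (comp (app (B.wkn 3) (var 1)) (f.wkn 3) (var 0)))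
      (var 0))

/-- The family `C ↦ (PC → C)` over `C : U`. -/
def algFam (A B : Tm) : Tm := arr (poly A.wk B.wk (var 0)) (var 0)

/-- The type of `P`-algebras, `Alg = (Σ C : U)(PC → C)`. -/
def Alg (A B : Tm) : Tm := sigma U (algFam A B)

/-- The carrier of a `P`-algebra. -/
def carrier (C : Tm) : Tm := fst U C

/-- The structure map `sup_C : PC → C` of a `P`-algebra. -/
def supMap (A B C : Tm) : Tm := snd U (algFam A B) C

/-- `isalghom(f) = Id(f ∘ sup_C, sup_D ∘ Pf)`, for `P`-algebras `C`, `D` and a function `f` between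
their carriers. -/
def isalghom (A B C D f : Tm) : Tm :=
  id (arr (poly A B (carrier C)) (carrier D))
    (comp (poly A B (carrier C)) f (supMap A B C))
    (comp (poly A B (carrier C)) (supMap A B D) (polyMap A B (carrier C) (carrier D) f))

/-- The type of `P`-algebra morphisms, `Alg(C, D) = (Σ f : C → D) isalghom(f)`. -/
def AlgHom (A B C D : Tm) : Tm :=
  sigma (arr (carrier C) (carrier D)) (isalghom A.wk B.wk C.wk D.wk (var 0))

/-- `ishinit(C) = (Π D : Alg) iscontr(Alg(C, D))` -/
def ishinit (A B C : Tm) : Tm := pi (Alg A B) (iscontr (AlgHom A.wk B.wk C.wk (var 0)))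

/-- `(Π C : Alg)(Π D : Alg)(ishinit(C) × ishinit(D) → iscontr(Id_Alg(C, D)))` -/
def hinitUnique (A B : Tm) : Tm :=
  pi (Alg A B) (pi (Alg A B).wk
    (arr (prod (ishinit (A.wkn 2) (B.wkn 2) (var 1)) (ishinit (A.wkn 2) (B.wkn 2) (var 0)))
      (iscontr (id ((Alg A B).wkn 2) (var 1) (var 0)))))

end Tm

end HTT

/-!
The mathematical argument. Write `P` for the polynomial functor of `A` and `B`, and let `C`, `D` be
homotopy-initial algebras. The centres of `Alg(C, D)` and `Alg(D, C)` are morphisms `f` and `g`.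
Morphisms compose and identities are morphisms, so `g ∘ f` and `1_C` both underlie elements of the
contractible type `Alg(C, C)` and are equal; likewise `f ∘ g` and `1_D`. Hence `f` is an equivalence:
the fibre of `f` over `y` is a retract of the fibre of `f ∘ g` over `y`, and that fibre is
contractible because `f ∘ g` is equal to `1_D`. By univalence `f` may be taken to be the map induced
by a path between the carriers, and `Id`-elimination on that path reduces the claim `Id_Alg(C, D)`
to the case `f = 1`, where the morphism condition says that the two structure maps are equal. So there
is a path `s(C, D, c, d) : Id_Alg(C, D)` depending on proofs `c`, `d` of homotopy-initiality.

For contractibility put `k(C, D, c, d) = s(C, C, c, c)⁻¹ · s(C, D, c, d)`. Every `p : Id_Alg(C, D)` is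
equal to `k(C, D, c, d)`: by `Id`-elimination it suffices that `k(C, C, c, d)` is equal to `refl(C)`,
and this holds for `c = d`, whence for all `c` and `d` since `ishinit(C)` is a proposition.

The derivations. Each step of this argument is an explicit term of the type theory. That a term has
the type claimed is verified by a type checker, `HTT.check`, which computes normal forms and
types together. Its soundness, `HTT.sound`, says that whatever it computes is derivable. No
injectivity of type constructors is used: whenever a computation rule applies to an introduction form,
`HTT.Val` provides the typing of its parts with respect to the very same type, and all other
coincidences of types are tested by the checker. The terms are checked one at a time in the context
`A : U`, `B : A → U` extended by the statements of the steps on which they rely, and the hypotheses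
are discharged by substitution (`HTT.Inh.of_extend`).
-/

namespace HTT

open Tm Judgement

/-! ### The calculus of substitutions -/

namespace Tm

theorem up_var : up var = var := by
  funext i; cases i <;> rfl

theorem sub_var (t : Tm) : t.sub var = t := by
  induction t <;> simp_all [sub, up_var]

theorem up_ren (ρ : ℕ → ℕ) : up (fun i => var (ρ i)) = fun i => var (upr ρ i) := by
  funext i; cases i <;> rfl

theorem ren_eq_sub (ρ : ℕ → ℕ) (t : Tm) : t.ren ρ = t.sub fun i => var (ρ i) := by
  induction t generalizing ρ <;> simp_all [sub, ren, up_ren]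

theorem up_upr (σ : ℕ → Tm) (ρ : ℕ → ℕ) : (fun i => up σ (upr ρ i)) = up fun i => σ (ρ i) := by
  funext i; cases i <;> rfl

theorem sub_ren (ρ : ℕ → ℕ) (σ : ℕ → Tm) (t : Tm) :
    (t.ren ρ).sub σ = t.sub fun i => σ (ρ i) := by
  induction t generalizing ρ σ <;> simp_all [sub, ren, up_upr]

theorem ren_ren (ρ τ : ℕ → ℕ) (t : Tm) : (t.ren ρ).ren τ = t.ren fun i => τ (ρ i) := by
  rw [ren_eq_sub τ, sub_ren, ren_eq_sub]

theorem up_ren_comp (σ : ℕ → Tm) (ρ : ℕ → ℕ) :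
    (fun i => (up σ i).ren (upr ρ)) = up fun i => (σ i).ren ρ := by
  funext i
  cases i with
  | zero => rfl
  | succ i => simp only [up, wk, wkn, ren_ren, upr]

theorem ren_sub (σ : ℕ → Tm) (ρ : ℕ → ℕ) (t : Tm) :
    (t.sub σ).ren ρ = t.sub fun i => (σ i).ren ρ := by
  induction t generalizing ρ σ <;> simp_all [sub, ren, up_ren_comp]

theorem up_comp (σ τ : ℕ → Tm) : (fun i => (up σ i).sub (up τ)) = up fun i => (σ i).sub τ := by
  funext i
  cases i with
  | zero => rfl
  | succ i => simp only [up, wk, wkn, sub_ren, ren_sub]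

theorem sub_sub (σ τ : ℕ → Tm) (t : Tm) : (t.sub σ).sub τ = t.sub fun i => (σ i).sub τ := by
  induction t generalizing σ τ <;> simp_all [sub, up_comp]

theorem wk_sub (t : Tm) (σ : ℕ → Tm) : t.wk.sub σ = t.sub fun i => σ (i + 1) := by
  rw [wk, wkn, sub_ren]

theorem wk_eq_sub (t : Tm) : t.wk = t.sub fun i => var (i + 1) := by
  rw [wk, wkn, ren_eq_sub]

theorem wk_sub_up (t : Tm) (σ : ℕ → Tm) : t.wk.sub (up σ) = (t.sub σ).wk := by
  rw [wk_sub, wk_eq_sub, sub_sub]; congr 1; funext i; simp only [up, wk_eq_sub]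

theorem wkn_succ (t : Tm) (k : ℕ) : (t.wkn k).wk = t.wkn (k + 1) := by
  simp only [wk, wkn, ren_ren]; rfl

theorem wkn_two (t : Tm) : t.wkn 2 = t.wk.wk := by rw [← wkn_succ]; rfl

end Tm

theorem Judgement.sub_var (𝓙 : Judgement) : 𝓙.sub var = 𝓙 := by
  cases 𝓙 <;> simp [Judgement.sub, Tm.sub_var]

/-! ### Contexts -/

/-- A context all of whose entries are types over the preceding ones. -/
def WfCtx : Ctx → Prop
  | [] => True
  | A :: Γ => Der Γ (isType A) ∧ WfCtx Γ

theorem WfCtx.ctx : ∀ {Γ : Ctx}, WfCtx Γ → Der Γ ctx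
  | [], _ => .ctx_nil
  | _ :: _, h => .ctx_cons h.1

theorem Der.wfCtx {Γ : Ctx} {𝓙 : Judgement} (h : Der Γ 𝓙) : WfCtx Γ := by
  induction h with
  | ctx_nil => trivial
  | ctx_cons h ih => exact ⟨h, ih⟩
  | weaken h _ ih _ => exact ⟨h, ih⟩
  | subst h _ _ ih _ _ => exact ih
  | _ => first | assumption | exact (‹WfCtx (_ :: _)›).2

theorem Der.wfCtx_cons {Γ : Ctx} {A : Tm} (h : Der Γ (isType A)) : WfCtx (A :: Γ) :=
  ⟨h, h.wfCtx⟩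

theorem Judgement.wk_eq_sub (𝓙 : Judgement) : 𝓙.wk = 𝓙.sub fun i => Tm.var (i + 1) := by
  cases 𝓙 <;> simp [Judgement.sub, Judgement.wk, Tm.wk_eq_sub]

/-- `σ` is a context morphism from `Γ` to `Δ`. -/
def TypedSub (Γ Δ : Ctx) (σ : ℕ → Tm) : Prop :=
  ∀ i A, Lookup Δ i A → Der Γ (hasType (σ i) (A.sub σ))

namespace TypedSub

theorem nil {Γ : Ctx} (σ : ℕ → Tm) : TypedSub Γ [] σ := nofun

theorem cons {Γ Δ : Ctx} {σ : ℕ → Tm} {a A : Tm} (hσ : TypedSub Γ Δ σ)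
    (ha : Der Γ (hasType a (A.sub σ))) : TypedSub Γ (A :: Δ) (scons a σ) := by
  rintro _ _ (_ | h)
  · rw [wk_sub]; exact ha
  · rw [wk_sub]; exact hσ _ _ h

theorem weaken {Γ : Ctx} {A : Tm} (hA : Der Γ (isType A)) :
    TypedSub (A :: Γ) Γ fun i => .var (i + 1) := by
  intro i B h
  rw [← Tm.wk_eq_sub]
  exact .var (.ctx_cons hA) (.there h)

theorem up {Γ Δ : Ctx} {σ : ℕ → Tm} {A : Tm} (hσ : TypedSub Γ Δ σ)
    (hA : Der Γ (isType (A.sub σ))) : TypedSub (A.sub σ :: Γ) (A :: Δ) (up σ) := by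
  rintro _ _ (_ | h)
  · rw [wk_sub_up]; exact .var (.ctx_cons hA) .here
  · rw [wk_sub_up]; exact .weaken hA (hσ _ _ h)

theorem refl {Γ : Ctx} (h : Der Γ ctx) : TypedSub Γ Γ var := by
  intro i A hi
  rw [Tm.sub_var]; exact .var h hi

end TypedSub

/-- Context conversion. -/
theorem Der.conv_ctx {Γ : Ctx} {A A' : Tm} {𝓙 : Judgement} (hA : Der Γ (isType A))
    (e : Der Γ (eqType A A')) (h : Der (A' :: Γ) 𝓙) :
    Der (A :: Γ) 𝓙 := by
  rw [← 𝓙.sub_var]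
  refine .subst (.ctx_cons hA) ?_ h
  rintro _ _ (_ | hi)
  · rw [Tm.sub_var]
    exact .conv (.var (.ctx_cons hA) .here) (.weaken hA e)
  · rw [Tm.sub_var]
    exact .var (.ctx_cons hA) (.there hi)

theorem WfCtx.isType_of_lookup {Γ : Ctx} {i : ℕ} {A : Tm} (hΓ : WfCtx Γ) (h : Lookup Γ i A) :
    Der Γ (isType A) := by
  induction h with
  | here => exact .weaken hΓ.1 hΓ.1
  | there h ih => exact .weaken hΓ.1 (ih hΓ.2)

theorem Der.inst {Γ : Ctx} {A a : Tm} {𝓙 : Judgement} (h : Der (A :: Γ) 𝓙)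
    (ha : Der Γ (hasType a A)) : Der Γ (𝓙.sub (scons a Tm.var)) :=
  have hΓ := ha.wfCtx.ctx
  .subst hΓ ((TypedSub.refl hΓ).cons (by rwa [Tm.sub_var])) h

/-! ### Generation for type formers -/

/-- What the well-formedness of an expression says of its immediate subexpressions if it is a
variable or a type former. -/
def TypeGen (Γ : Ctx) : Tm → Prop
  | .var i => ∃ A, Lookup Γ i A
  | .pi A B => Der (A :: Γ) (isType B)
  | .sigma A B => Der (A :: Γ) (isType B)
  | .id A a b => Der Γ (isType A) ∧ Der Γ (hasType a A) ∧ Der Γ (hasType b A)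
  | _ => True

theorem TypeGen.sub {Γ Δ : Ctx} {σ : ℕ → Tm} (hΓ : Der Γ ctx) (hσ : TypedSub Γ Δ σ)
    (hvar : ∀ i A, Lookup Δ i A → TypeGen Γ (σ i)) :
    ∀ {X : Tm}, TypeGen Δ X → TypeGen Γ (X.sub σ)
  | .var _, ⟨_, h⟩ => hvar _ _ h
  | .pi _ _, h => by
    have hA := Der.subst hΓ hσ h.wfCtx.1
    exact Der.subst (.ctx_cons hA) (hσ.up hA) h
  | .sigma _ _, h => by
    have hA := Der.subst hΓ hσ h.wfCtx.1
    exact Der.subst (.ctx_cons hA) (hσ.up hA) h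
  | .id _ _ _, ⟨h, h₁, h₂⟩ => ⟨.subst hΓ hσ h, .subst hΓ hσ h₁, .subst hΓ hσ h₂⟩
  | .U, _ | .lam _ _, _ | .app _ _, _ | .pair _ _ _, _ | .split _ _ _, _ | .refl _, _
  | .J _ _ _ _ _, _ | .funext _ _ _, _ => trivial

/-- `TypeGen` for the subject of a judgement. -/
def JudgGen (Γ : Ctx) : Judgement → Prop
  | isType A => TypeGen Γ A
  | hasType a _ => TypeGen Γ a
  | _ => True

/-- Generation: the parts of a well-formed type former are well formed. Stated for types and terms
at once because of `U`. -/
theorem Der.gen {Γ : Ctx} {𝓙 : Judgement} (h : Der Γ 𝓙) : JudgGen Γ 𝓙 := by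
  induction h with
  | var _ h => exact ⟨_, h⟩
  | @weaken Γ A 𝓙 hA h _ ih =>
    have key {X : Tm} : TypeGen Γ X → _ := TypeGen.sub (.ctx_cons hA) (TypedSub.weaken hA) fun i A hi => ⟨_, .there hi⟩
    rw [Judgement.wk_eq_sub]
    cases 𝓙 <;> first | exact key ih | trivial
  | @subst Γ Δ σ 𝓙 hΓ hσ h _ ihσ ih =>
    have key {X : Tm} : TypeGen Δ X → _ := TypeGen.sub hΓ hσ fun i A hi => ihσ i A hi
    cases 𝓙 <;> first | exact key ih | trivial
  | conv _ _ ih _ => exact ih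
  | sigma_form h _ => exact h
  | pi_form h _ => exact h
  | id_form h h₁ h₂ => exact ⟨h, h₁, h₂⟩
  | U_type _ ih => exact ih
  | U_sigma _ h => exact .U_type h
  | U_pi _ h => exact .U_type h
  | U_id h h₁ h₂ => exact ⟨.U_type h, h₁, h₂⟩
  | _ => trivial

/-! ### Judgemental equality with its presuppositions -/

/-- `A` and `A'` are judgementally equal types. Well-formedness of both sides is included. -/
structure TyEq (Γ : Ctx) (A A' : Tm) : Prop where
  left : Der Γ (isType A)
  right : Der Γ (isType A')
  eq : Der Γ (eqType A A')

/-- `t` and `t'` are judgementally equal elements of the type `T`. The presuppositions of the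
equality judgement are included. -/
structure TmEq (Γ : Ctx) (t t' T : Tm) : Prop where
  type : Der Γ (isType T)
  left : Der Γ (hasType t T)
  right : Der Γ (hasType t' T)
  eq : Der Γ (eqTerm t t' T)

section
variable {Γ : Ctx} {A A' B B' E E' S T a a' b b' c c' e e' f f' g g' p p' t u w α α' : Tm}

theorem TyEq.refl (h : Der Γ (isType A)) : TyEq Γ A A := ⟨h, h, .eqType_refl h⟩

theorem TyEq.symm (h : TyEq Γ A A') : TyEq Γ A' A := ⟨h.right, h.left, .eqType_symm h.eq⟩

theorem TyEq.trans (h : TyEq Γ A B) (h' : TyEq Γ B T) : TyEq Γ A T :=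
  ⟨h.left, h'.right, .eqType_trans h.eq h'.eq⟩

theorem TyEq.conv_ctx (hA : TyEq Γ A A') (h : TyEq (A' :: Γ) B B') : TyEq (A :: Γ) B B' :=
  ⟨.conv_ctx hA.left hA.eq h.left, .conv_ctx hA.left hA.eq h.right, .conv_ctx hA.left hA.eq h.eq⟩

theorem TmEq.conv_ctx (hA : TyEq Γ A A') (h : TmEq (A' :: Γ) t u B) : TmEq (A :: Γ) t u B :=
  ⟨.conv_ctx hA.left hA.eq h.type, .conv_ctx hA.left hA.eq h.left,
    .conv_ctx hA.left hA.eq h.right, .conv_ctx hA.left hA.eq h.eq⟩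

theorem TmEq.refl (hT : Der Γ (isType T)) (h : Der Γ (hasType t T)) : TmEq Γ t t T :=
  ⟨hT, h, h, .eqTerm_refl h⟩

theorem TmEq.trans (h : TmEq Γ t u T) (h' : TmEq Γ u w T) : TmEq Γ t w T :=
  ⟨h.type, h.left, h'.right, .eqTerm_trans h.eq h'.eq⟩

theorem TmEq.conv (h : TmEq Γ t u S) (hT : TyEq Γ S T) : TmEq Γ t u T :=
  ⟨hT.right, .conv h.left hT.eq, .conv h.right hT.eq, .conv_eq h.eq hT.eq⟩

theorem TmEq.wfCtx (h : TmEq Γ t u T) : WfCtx Γ := h.eq.wfCtx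

theorem TmEq.toTyEq (h : TmEq Γ A A' .U) : TyEq Γ A A' :=
  ⟨.U_type h.left, .U_type h.right, .U_eqType h.eq⟩

theorem TyEq.sub {Δ : Ctx} {σ : ℕ → Tm} (h : TyEq Δ A A') (hΓ : Der Γ ctx)
    (hσ : TypedSub Γ Δ σ) : TyEq Γ (A.sub σ) (A'.sub σ) :=
  ⟨.subst hΓ hσ h.left, .subst hΓ hσ h.right, .subst hΓ hσ h.eq⟩

theorem TypedSub.inst (ha : Der Γ (hasType a A)) : TypedSub Γ (A :: Γ) (scons a Tm.var) :=
  (TypedSub.refl ha.wfCtx.ctx).cons (by rwa [Tm.sub_var])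

theorem TyEq.inst (h : TyEq (A :: Γ) B B') (ha : TmEq Γ a a' A) :
    TyEq Γ (B.inst a) (B'.inst a') :=
  (h.sub ha.wfCtx.ctx (.inst ha.left)).trans
    ⟨h.right.inst ha.left, h.right.inst ha.right,
      .subst_eqType h.right ha.eq⟩

theorem TyEq.pi (hA : TyEq Γ A A') (hB : TyEq (A' :: Γ) B B') : TyEq Γ (pi A B) (pi A' B') :=
  ⟨.pi_form (hA.conv_ctx hB).left, .pi_form hB.right, .pi_cong hA.eq (hA.conv_ctx hB).eq⟩

theorem TyEq.sigma (hA : TyEq Γ A A') (hB : TyEq (A' :: Γ) B B') :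
    TyEq Γ (sigma A B) (sigma A' B') :=
  ⟨.sigma_form (hA.conv_ctx hB).left, .sigma_form hB.right, .sigma_cong hA.eq (hA.conv_ctx hB).eq⟩

theorem TyEq.id (hA : TyEq Γ A A') (ha : TmEq Γ a a' A') (hb : TmEq Γ b b' A') :
    TyEq Γ (id A a b) (id A' a' b') :=
  have ha' := ha.conv hA.symm
  have hb' := hb.conv hA.symm
  ⟨.id_form hA.left ha'.left hb'.left, .id_form hA.right ha.right hb.right,
    .id_cong hA.eq ha'.eq hb'.eq⟩

theorem TmEq.pi (hA : TmEq Γ A A' .U) (hB : TmEq (A' :: Γ) B B' .U) :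
    TmEq Γ (pi A B) (pi A' B') .U :=
  have hB' := hB.conv_ctx hA.toTyEq
  ⟨hA.type, .U_pi hA.left hB'.left, .U_pi hA.right hB.right, .U_pi_cong hA.eq hB'.eq⟩

theorem TmEq.sigma (hA : TmEq Γ A A' .U) (hB : TmEq (A' :: Γ) B B' .U) :
    TmEq Γ (sigma A B) (sigma A' B') .U :=
  have hB' := hB.conv_ctx hA.toTyEq
  ⟨hA.type, .U_sigma hA.left hB'.left, .U_sigma hA.right hB.right, .U_sigma_cong hA.eq hB'.eq⟩

theorem TmEq.id (hA : TmEq Γ A A' .U) (ha : TmEq Γ a a' A') (hb : TmEq Γ b b' A') :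
    TmEq Γ (id A a b) (id A' a' b') .U :=
  have ha' := ha.conv hA.toTyEq.symm
  have hb' := hb.conv hA.toTyEq.symm
  ⟨hA.type, .U_id hA.left ha'.left hb'.left, .U_id hA.right ha.right hb.right,
    .U_id_cong hA.eq ha'.eq hb'.eq⟩

theorem TmEq.lam (hA : TyEq Γ A A') (hb : TmEq (A' :: Γ) b b' B) :
    TmEq Γ (.lam A b) (.lam A' b') (.pi A' B) :=
  have hb' := hb.conv_ctx hA
  have e : TyEq Γ (.pi A B) (.pi A' B) := hA.pi (.refl hb.type)
  ⟨e.right, .conv (.lam_intro hb'.left) e.eq, .lam_intro hb.right,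
    .conv_eq (.lam_cong hA.eq hb'.eq) e.eq⟩

theorem TmEq.eta (hf : Der Γ (isType (.pi A B))) (h : Der Γ (hasType f (.pi A B)))
    (hl : Der Γ (hasType (.lam A (.app f.wk (.var 0))) (.pi A B))) :
    TmEq Γ (.lam A (.app f.wk (.var 0))) f (.pi A B) :=
  ⟨hf, hl, h, .eqTerm_symm (.pi_eta h)⟩

theorem TmEq.app (hf : TmEq Γ f f' (.pi A B)) (ha : TmEq Γ a a' A) :
    TmEq Γ (.app f a) (.app f' a') (B.inst a') :=
  have e : TyEq Γ (B.inst a) (B.inst a') := TyEq.inst (.refl hf.type.gen) ha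
  ⟨e.right, .conv (.app_elim hf.left ha.left) e.eq, .app_elim hf.right ha.right,
    .conv_eq (.app_cong hf.eq ha.eq) e.eq⟩

theorem TmEq.beta (hB : Der (A :: Γ) (isType B)) (hb : Der (A :: Γ) (hasType b B))
    (ha : Der Γ (hasType a A)) : TmEq Γ (.app (.lam A b) a) (b.inst a) (B.inst a) :=
  ⟨hB.inst ha, .app_elim (.lam_intro hb) ha, hb.inst ha, .app_comp hb ha⟩

theorem TmEq.pair (ha : TmEq Γ a a' A) (hB : TyEq (A :: Γ) B B')
    (hb : TmEq Γ b b' (B'.inst a')) : TmEq Γ (.pair B a b) (.pair B' a' b') (.sigma A B') :=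
  have hA := hB.eq.wfCtx.1
  have e : TyEq Γ (.sigma A B) (.sigma A B') := (TyEq.refl hA).sigma hB
  have hb' := hb.conv (hB.inst ha).symm
  ⟨e.right, .conv (.pair_intro hB.left ha.left hb'.left) e.eq,
    .pair_intro hB.right ha.right hb.right, .conv_eq (.pair_cong hB.eq ha.eq hb'.eq) e.eq⟩

/-- The substitution `z ↦ pair(x, y)` that defines `splitCase`. -/
theorem TypedSub.splitCase (hB : Der (A :: Γ) (isType B)) :
    TypedSub (B :: A :: Γ) (.sigma A B :: Γ)
      (scons (.pair (B.ren (upr fun i => i + 2)) (.var 1) (.var 0)) fun i => .var (i + 2)) := by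
  have hA := hB.wfCtx.1
  have h₁ := TypedSub.weaken hA
  have h₂ : TypedSub (B :: A :: Γ) Γ fun i => .var (i + 2) := by
    intro i C hi
    have := Der.var (.ctx_cons hB) (.there (.there hi))
    rwa [← wkn_two, wkn, ren_eq_sub] at this
  refine h₂.cons ?_
  have hB' := Der.subst (.ctx_cons (Der.subst (.ctx_cons hB) h₂ hA))
    (h₂.up (Der.subst (.ctx_cons hB) h₂ hA)) hB
  rw [ren_eq_sub, ← up_ren]
  refine .pair_intro hB' ?_ ?_
  · have := Der.var (.ctx_cons hB) (.there .here)
    rwa [← wkn_two, wkn, ren_eq_sub] at this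
  · have := Der.var (.ctx_cons hB) .here
    convert this using 2
    rw [Tm.inst, sub_sub, Tm.wk_eq_sub]
    congr 1
    funext i
    rcases i with _ | i <;> rfl

theorem TmEq.split (hE : TyEq (.sigma A B :: Γ) E E')
    (he : TmEq (B :: A :: Γ) e e' (splitCase B E')) (hc : TmEq Γ c c' (.sigma A B)) :
    TmEq Γ (.split E e c) (.split E' e' c') (E'.inst c') :=
  have hB : Der (A :: Γ) (isType B) := hc.type.gen
  have e₁ : TyEq _ (splitCase B E) (splitCase B E') := hE.sub he.wfCtx.ctx (.splitCase hB)
  have he' := he.conv e₁.symm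
  have e₂ := hE.inst hc
  ⟨e₂.right, .conv (.split_elim hE.left he'.left hc.left) e₂.eq,
    .split_elim hE.right he.right hc.right, .conv_eq (.split_cong hE.eq he'.eq hc.eq) e₂.eq⟩

theorem Der.inst2 {𝓙 : Judgement} (h : Der (B :: A :: Γ) 𝓙) (ha : Der Γ (hasType a A))
    (hb : Der Γ (hasType b (B.inst a))) : Der Γ (𝓙.sub (scons b (scons a Tm.var))) :=
  .subst ha.wfCtx.ctx ((TypedSub.inst ha).cons hb) h

theorem splitCase_inst2 (B E a b : Tm) : (splitCase B E).inst2 a b = E.inst (.pair B a b) := by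
  rw [splitCase, Tm.inst2, sub_sub, Tm.inst]
  congr 1
  funext i
  rcases i with _ | i
  · simp only [scons, Tm.sub]
    rw [sub_ren]
    congr 1
    convert sub_var B using 2
    funext i
    rcases i with _ | i <;> rfl
  · rfl

theorem TmEq.split_pair (hE : Der (.sigma A B :: Γ) (isType E))
    (he : Der (B :: A :: Γ) (hasType e (splitCase B E))) (ha : Der Γ (hasType a A))
    (hb : Der Γ (hasType b (B.inst a))) :
    TmEq Γ (.split E e (.pair B a b)) (e.inst2 a b) (E.inst (.pair B a b)) := by
  have hp := Der.pair_intro he.wfCtx.1 ha hb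
  have := he.inst2 ha hb
  rw [Judgement.sub, ← Tm.inst2, ← Tm.inst2, splitCase_inst2] at this
  exact ⟨hE.inst hp, .split_elim hE he hp, this, .split_comp hE he ha hb⟩

theorem TmEq.reflTm (ha : TmEq Γ a a' A) : TmEq Γ (Tm.refl a) (Tm.refl a') (.id A a' a') :=
  have e : TyEq Γ (.id A a a) (.id A a' a') := .id (.refl ha.type) ha ha
  ⟨e.right, .conv (.refl_intro ha.left) e.eq, .refl_intro ha.right,
    .conv_eq (.refl_cong ha.eq) e.eq⟩

/-- The context `x : A`, `y : A`, `u : Id_A(x, y)` of the motive of `J`. -/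
abbrev JCtx (A : Tm) (Γ : Ctx) : Ctx := .id (A.wkn 2) (.var 1) (.var 0) :: A.wk :: A :: Γ

theorem wfCtx_JCtx (hA : Der Γ (isType A)) : WfCtx (JCtx A Γ) := by
  have h₁ := Der.weaken hA hA
  have h₂ := Der.weaken h₁ h₁
  refine ⟨?_, h₁, hA, hA.wfCtx⟩
  rw [wkn_two]
  exact .id_form h₂ (.var (.ctx_cons h₁) (.there .here)) (.var (.ctx_cons h₁) .here)

theorem TypedSub.JCtx {Δ : Ctx} {σ : ℕ → Tm} (hσ : TypedSub Γ Δ σ)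
    (ha : Der Γ (hasType a (A.sub σ)))
    (hb : Der Γ (hasType b (A.sub σ))) (hp : Der Γ (hasType p (.id (A.sub σ) a b))) :
    TypedSub Γ (JCtx A Δ) (scons p (scons b (scons a σ))) := by
  refine ((hσ.cons ha).cons (by rwa [wk_sub])).cons ?_
  rw [wkn_two]
  simp only [Tm.sub, wk_sub]
  exact hp

/-- The substitution `x, y, u ↦ x, x, refl(x)` that defines `JCase`. -/
theorem TypedSub.JCase (hA : Der Γ (isType A)) :
    TypedSub (A :: Γ) (HTT.JCtx A Γ)
      (scons (.refl (.var 0)) (scons (.var 0) (scons (.var 0) fun i => .var (i + 1)))) := by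
  have h : Der (A :: Γ) (hasType (.var 0) (A.sub fun i => .var (i + 1))) := by
    rw [← Tm.wk_eq_sub]; exact .var (.ctx_cons hA) .here
  exact (TypedSub.weaken hA).JCtx h h (.refl_intro h)

theorem TypedSub.inst3 (ha : Der Γ (hasType a A)) (hb : Der Γ (hasType b A))
    (hp : Der Γ (hasType p (.id A a b))) :
    TypedSub Γ (HTT.JCtx A Γ) (scons p (scons b (scons a Tm.var))) :=
  (TypedSub.refl ha.wfCtx.ctx).JCtx (by rwa [Tm.sub_var]) (by rwa [Tm.sub_var])
    (by rwa [Tm.sub_var])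

/-- Congruence for `J`. That the types of both sides agree is assumed: the rules allow equal terms to
be substituted in a type for one variable at a time only. -/
theorem TmEq.J (hE : TyEq (JCtx A Γ) E E') (he : TmEq (A :: Γ) e e' (JCase E'))
    (ha : TmEq Γ a a' A) (hb : TmEq Γ b b' A) (hp : TmEq Γ p p' (.id A a' b'))
    (hT : TyEq Γ (E'.inst3 a b p) T) (hT' : TyEq Γ (E'.inst3 a' b' p') T) :
    TmEq Γ (.J E e a b p) (.J E' e' a' b' p') T :=
  have hA := ha.type
  have e₁ : TyEq _ (JCase E) (JCase E') := hE.sub he.wfCtx.ctx (.JCase hA)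
  have he' := he.conv e₁.symm
  have hp' := hp.conv (TyEq.id (.refl hA) ha hb).symm
  have e₂ : TyEq Γ (E.inst3 a b p) (E'.inst3 a b p) :=
    hE.sub ha.wfCtx.ctx (TypedSub.inst3 ha.left hb.left hp'.left)
  have e₃ := e₂.trans hT
  ⟨hT.right, .conv (.J_elim hE.left he'.left ha.left hb.left hp'.left) e₃.eq,
    .conv (.J_elim hE.right he.right ha.right hb.right hp.right) hT'.eq,
    .conv_eq (.J_cong hE.eq he'.eq ha.eq hb.eq hp'.eq) e₃.eq⟩

theorem JCase_inst (E a : Tm) : (JCase E).inst a = E.inst3 a a (.refl a) := by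
  rw [JCase, Tm.inst, sub_sub, Tm.inst3]
  congr 1
  funext i
  rcases i with _ | _ | _ | i <;> rfl

theorem TmEq.J_refl (hE : Der (JCtx A Γ) (isType E)) (he : Der (A :: Γ) (hasType e (JCase E)))
    (ha : Der Γ (hasType a A)) :
    TmEq Γ (.J E e a a (.refl a)) (e.inst a) (E.inst3 a a (.refl a)) := by
  have := he.inst ha
  rw [Judgement.sub, ← Tm.inst, ← Tm.inst, JCase_inst] at this
  exact ⟨.subst ha.wfCtx.ctx (TypedSub.inst3 ha ha (.refl_intro ha)) hE,
    .J_elim hE he ha ha (.refl_intro ha), this, .J_comp hE he ha⟩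

theorem TmEq.app_wk (h : TmEq Γ f f' (.pi A B)) :
    TmEq (A :: Γ) (.app f.wk (.var 0)) (.app f'.wk (.var 0)) B := by
  have hB : Der (A :: Γ) (isType B) := h.type.gen
  have hA := hB.wfCtx.1
  have hv : Der (A :: Γ) (hasType (.var 0) A.wk) := .var (.ctx_cons hA) .here
  have := TmEq.app (A := A.wk) (B := B.ren (upr fun i => i + 1))
    ⟨.weaken hA h.type, .weaken hA h.left, .weaken hA h.right, .weaken hA h.eq⟩
    (.refl (.weaken hA hA) hv)
  convert this using 1
  rw [Tm.inst, sub_ren]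
  convert (sub_var B).symm using 2
  funext i
  rcases i with _ | i <;> rfl

theorem TmEq.funext (hf : TmEq Γ f f' (.pi A B)) (hg : TmEq Γ g g' (.pi A B))
    (hα : TmEq (A :: Γ) α α' (.id B (.app f'.wk (.var 0)) (.app g'.wk (.var 0)))) :
    TmEq Γ (.funext f g α) (.funext f' g' α') (.id (.pi A B) f' g') := by
  have hB : Der (A :: Γ) (isType B) := hf.type.gen
  have e := TyEq.id (.refl hf.type) hf hg
  have hα' := hα.conv (TyEq.id (.refl hB) hf.app_wk hg.app_wk).symm
  exact ⟨e.right, .conv (.funext_ax hf.left hg.left hα'.left) e.eq,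
    .funext_ax hf.right hg.right hα.right, .conv_eq (.funext_cong hf.eq hg.eq hα'.eq) e.eq⟩

end

/-! ### A normalizing type checker -/

/-- Syntactic equality of expressions, as a Boolean function. -/
def Tm.beq : Tm → Tm → Bool
  | .var i, .var j => Nat.beq i j
  | .U, .U => true
  | .pi A B, .pi A' B' => A.beq A' && B.beq B'
  | .sigma A B, .sigma A' B' => A.beq A' && B.beq B'
  | .id A a b, .id A' a' b' => A.beq A' && (a.beq a' && b.beq b')
  | .lam A b, .lam A' b' => A.beq A' && b.beq b'
  | .app f a, .app f' a' => f.beq f' && a.beq a'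
  | .pair B a b, .pair B' a' b' => B.beq B' && (a.beq a' && b.beq b')
  | .split E e c, .split E' e' c' => E.beq E' && (e.beq e' && c.beq c')
  | .refl a, .refl a' => a.beq a'
  | .J E e a b p, .J E' e' a' b' p' =>
      E.beq E' && (e.beq e' && (a.beq a' && (b.beq b' && p.beq p')))
  | .funext f g α, .funext f' g' α' => f.beq f' && (g.beq g' && α.beq α')
  | _, _ => false

/-- Whether an expression has no subexpression that a computation rule applies to. -/
def Tm.redexFree : Tm → Bool
  | .var _ => true
  | .U => true
  | .pi A B => A.redexFree && B.redexFree
  | .sigma A B => A.redexFree && B.redexFree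
  | .id A a b => A.redexFree && (a.redexFree && b.redexFree)
  | .lam A b => A.redexFree && b.redexFree
  | .app f a => (match f with | .lam _ _ => false | _ => true) && (f.redexFree && a.redexFree)
  | .pair B a b => B.redexFree && (a.redexFree && b.redexFree)
  | .split E e c => (match c with | .pair _ _ _ => false | _ => true) &&
      (E.redexFree && (e.redexFree && c.redexFree))
  | .refl a => a.redexFree
  | .J E e a b p => (match p with | .refl _ => false | _ => true) &&
      (E.redexFree && (e.redexFree && (a.redexFree && (b.redexFree && p.redexFree))))
  | .funext f g α => f.redexFree && (g.redexFree && α.redexFree)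

/-- Whether an expression is an introduction form. -/
def Tm.isIntro : Tm → Bool
  | .lam _ _ => true
  | .pair _ _ _ => true
  | .refl _ => true
  | _ => false

/-- The type of a variable, if it is declared in the context. -/
def lookup : Ctx → ℕ → Option Tm
  | [], _ => none
  | A :: _, 0 => some A.wk
  | _ :: Γ, i + 1 => (lookup Γ i).map wk

mutual
/-- The normal form of a term together with its type, which is computed in normal form as well; the
first argument bounds the depth of recursion. Functions of the form `λ x. f(x)` are contracted to
`f`. The result is `none` for expressions that are not well typed. -/
def nf : ℕ → Ctx → Tm → Option (Tm × Tm)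
  | 0, _, _ => none
  | _ + 1, Γ, .var i => (lookup Γ i).map fun T => (.var i, T)
  | _ + 1, _, .U => none
  | n + 1, Γ, .pi A B =>
      (nf n Γ A).bind fun (A', S) => if S.beq .U then
        (nf n (A' :: Γ) B).bind fun (B', T) => if T.beq .U then some (.pi A' B', .U) else none
      else none
  | n + 1, Γ, .sigma A B =>
      (nf n Γ A).bind fun (A', S) => if S.beq .U then
        (nf n (A' :: Γ) B).bind fun (B', T) => if T.beq .U then some (.sigma A' B', .U) else none
      else none
  | n + 1, Γ, .id A a b =>
      (nf n Γ A).bind fun (A', S) => if S.beq .U then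
        (nf n Γ a).bind fun (a', A₁) => if A₁.beq A' then
          (nf n Γ b).bind fun (b', A₂) => if A₂.beq A' then some (.id A' a' b', .U) else none
        else none
      else none
  | n + 1, Γ, .lam A b =>
      (nfTy n Γ A).bind fun A' => (nf n (A' :: Γ) b).bind fun (b', B) =>
        match b' with
        | .app f (.var 0) =>
          if (f.inst .U).wk.beq f then
            (nf n Γ (f.inst .U)).bind fun (g, T) =>
              if T.beq (.pi A' B) then some (g, T) else none
          else some (.lam A' b', .pi A' B)
        | _ => some (.lam A' b', .pi A' B)
  | n + 1, Γ, .app f a =>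
      (nf n Γ f).bind fun (f', F) => match F with
        | .pi A B => (nf n Γ a).bind fun (a', A₁) => if A₁.beq A then
            match f' with
            | .lam _ b => red n Γ (b.inst a') (B.inst a')
            | f' => (nfK n Γ (B.inst a')).map fun T => (.app f' a', T)
          else none
        | _ => none
  | n + 1, Γ, .pair B a b =>
      (nf n Γ a).bind fun (a', A) => (nfTy n (A :: Γ) B).bind fun B' =>
        (chk n Γ b (B'.inst a')).bind fun (b', _) => some (.pair B' a' b', .sigma A B')
  | n + 1, Γ, .split E e c =>
      (nf n Γ c).bind fun (c', F) => match F with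
        | .sigma A B => (nfTy n (.sigma A B :: Γ) E).bind fun E' =>
            (chk n (B :: A :: Γ) e (splitCase B E')).bind fun (e', _) =>
              match c' with
              | .pair _ a b => red n Γ (e'.inst2 a b) (E'.inst c')
              | c' => (nfK n Γ (E'.inst c')).map fun T => (.split E' e' c', T)
        | _ => none
  | n + 1, Γ, .refl a => (nf n Γ a).map fun (a', A) => (.refl a', .id A a' a')
  | n + 1, Γ, .J E e a b p =>
      (nf n Γ p).bind fun (p', F) => match F with
        | .id A a₁ b₁ =>
          (nf n Γ a).bind fun (a', A₁) => if A₁.beq A && a'.beq a₁ then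
            (nf n Γ b).bind fun (b', A₂) => if A₂.beq A && b'.beq b₁ then
              (nfTy n (.id (A.wkn 2) (.var 1) (.var 0) :: A.wk :: A :: Γ) E).bind fun E' =>
                (chk n (A :: Γ) e (JCase E')).bind fun (e', _) =>
                  (nfK n Γ (E'.inst3 a' b' p')).bind fun T =>
                    -- the type of the expression as given, `E'(a, b, p)`, has to agree with `T`
                    if (a'.beq a && (b'.beq b && p'.beq p)) ||
                        ((nfK n Γ (E'.inst3 a b p)).elim false fun S => S.beq T) then
                      match p' with
                      | .refl _ => red n Γ (e'.inst a') T
                      | p' => some (.J E' e' a' b' p', T)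
                    else none
            else none
          else none
        | _ => none
  | n + 1, Γ, .funext f g α =>
      (nf n Γ f).bind fun (f', F) => match F with
        | .pi A B => (nf n Γ g).bind fun (g', G) => if G.beq (.pi A B) then
            (chk n (A :: Γ) α (.id B (.app f'.wk (.var 0)) (.app g'.wk (.var 0)))).bind
              fun (α', _) => some (.funext f' g' α', .id (.pi A B) f' g')
          else none
        | _ => none

/-- The normal form of a type. -/
def nfTy : ℕ → Ctx → Tm → Option Tm
  | 0, _, _ => none
  | _ + 1, _, .U => some .U
  | n + 1, Γ, .pi A B =>
      (nfTy n Γ A).bind fun A' => (nfTy n (A' :: Γ) B).map fun B' => .pi A' B'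
  | n + 1, Γ, .sigma A B =>
      (nfTy n Γ A).bind fun A' => (nfTy n (A' :: Γ) B).map fun B' => .sigma A' B'
  | n + 1, Γ, .id A a b =>
      (nfTy n Γ A).bind fun A' =>
        (nf n Γ a).bind fun (a', A₁) => if A₁.beq A' then
          (nf n Γ b).bind fun (b', A₂) => if A₂.beq A' then some (.id A' a' b') else none
        else none
  | n + 1, Γ, A => (nf n Γ A).bind fun (A', S) => if S.beq .U then some A' else none

/-- The normal forms of a term and of its type, if the latter is that of the type `S`. -/
def chk : ℕ → Ctx → Tm → Tm → Option (Tm × Tm)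
  | 0, _, _, _ => none
  | n + 1, Γ, t, S =>
      (nf n Γ t).bind fun (t', T) => (nfK n Γ S).bind fun S' =>
        if T.beq S' then some (t', T) else none

/-- The normal form of an expression that is known to be a type. -/
def nfK : ℕ → Ctx → Tm → Option Tm
  | 0, _, _ => none
  | n + 1, Γ, S => if S.redexFree then some S else nfTy n Γ S

/-- The normal forms of a term `t` and its type, if `t` is known to have the type `S`. An introduction
form is always type checked again, so that the typing of its parts becomes known. -/
def red : ℕ → Ctx → Tm → Tm → Option (Tm × Tm)
  | 0, _, _, _ => none
  | n + 1, Γ, t, S =>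
      if t.redexFree && not t.isIntro then (nfK n Γ S).map fun S' => (t, S') else chk n Γ t S
end

/-- Normalization of the types declared in a context. -/
def nfCtx (n : ℕ) : Ctx → Option Ctx
  | [] => some []
  | A :: Γ => (nfCtx n Γ).bind fun Γ' => (nfTy n Γ' A).map fun A' => A' :: Γ'

/-- Whether `t : T` in the context `Γ` is confirmed with recursion depth at most `n`. -/
def check (n : ℕ) (Γ : Ctx) (t T : Tm) : Bool :=
  (nfCtx n Γ).elim false fun Γ' => (nfTy n Γ' T).elim false fun T' => (chk n Γ' t T').isSome

/-! ### Soundness of the type checker -/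

theorem Tm.beq_sound {t u : Tm} (h : t.beq u = true) : t = u := by
  fun_induction Tm.beq t u <;> simp_all

theorem lookup_sound : ∀ {Γ : Ctx} {i : ℕ} {T : Tm}, lookup Γ i = some T → Lookup Γ i T
  | _ :: _, 0, _, rfl => .here
  | _ :: Γ, i + 1, T, h => by
    simp only [lookup, Option.map_eq_some_iff] at h
    obtain ⟨S, h, rfl⟩ := h
    exact .there (lookup_sound h)

/-- For an introduction form `t` of type `T`, what computation rules need to know about its parts. -/
def Val (Γ : Ctx) : Tm → Tm → Prop
  | .lam A b, T => ∃ B, T = .pi A B ∧ Der (A :: Γ) (hasType b B)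
  | .pair B a b, T => ∃ A, T = .sigma A B ∧ Der Γ (hasType a A) ∧ Der Γ (hasType b (B.inst a))
  | .refl a, T => ∃ A, T = .id A a a ∧ Der Γ (hasType a A)
  | _, _ => True

theorem Val.of_isIntro_eq_false {Γ : Ctx} : ∀ {t T : Tm}, t.isIntro = false → Val Γ t T
  | .var _, _, _ | .U, _, _ | .pi _ _, _, _ | .sigma _ _, _, _ | .id _ _ _, _, _
  | .app _ _, _, _ | .split _ _ _, _, _ | .J _ _ _ _ _, _, _ | .funext _ _ _, _, _ => trivial

/-- `t'` is a result of evaluating `t : T`. -/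
structure Nf (Γ : Ctx) (t t' T : Tm) : Prop extends TmEq Γ t t' T where
  val : Val Γ t' T

theorem Nf.of_red {Γ : Ctx} {t u S T t' : Tm} (h : TmEq Γ t u S) (hT : TyEq Γ S T)
    (h' : Nf Γ u t' T) : Nf Γ t t' T :=
  ⟨(h.conv hT).trans h'.toTmEq, h'.val⟩

/-- The functions of the type checker are sound at recursion depth `n`. -/
structure Sound (n : ℕ) : Prop where
  nf : ∀ {Γ t t' T}, WfCtx Γ → nf n Γ t = some (t', T) → Nf Γ t t' T
  nfTy : ∀ {Γ A A'}, WfCtx Γ → nfTy n Γ A = some A' → TyEq Γ A A'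
  chk : ∀ {Γ t S t' T}, Der Γ (isType S) → chk n Γ t S = some (t', T) →
    TyEq Γ S T ∧ Nf Γ t t' T
  nfK : ∀ {Γ S S'}, Der Γ (isType S) → nfK n Γ S = some S' → TyEq Γ S S'
  red : ∀ {Γ t u S t' T}, TmEq Γ t u S → red n Γ u S = some (t', T) → Nf Γ t t' T

section
variable {n : ℕ} {Γ : Ctx}

theorem Sound.chk_tmEq (ih : Sound n) {t S : Tm} {r : Tm × Tm} (hS : Der Γ (isType S))
    (h : HTT.chk n Γ t S = some r) : TmEq Γ t r.1 S :=
  have h' := ih.chk (T := r.2) hS h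
  h'.2.toTmEq.conv h'.1.symm

theorem Sound.nfTy_succ (ih : Sound n) {A A' : Tm} (hΓ : WfCtx Γ)
    (h : HTT.nfTy (n + 1) Γ A = some A') : TyEq Γ A A' := by
  cases A with
  | U =>
    rw [HTT.nfTy] at h
    cases h
    exact .refl (.U_form hΓ.ctx)
  | pi A B =>
    simp only [HTT.nfTy, Option.bind_eq_some_iff, Option.map_eq_some_iff] at h
    obtain ⟨A', hA, B', hB, rfl⟩ := h
    have hA := ih.nfTy hΓ hA
    exact hA.pi (ih.nfTy hA.right.wfCtx_cons hB)
  | sigma A B =>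
    simp only [HTT.nfTy, Option.bind_eq_some_iff, Option.map_eq_some_iff] at h
    obtain ⟨A', hA, B', hB, rfl⟩ := h
    have hA := ih.nfTy hΓ hA
    exact hA.sigma (ih.nfTy hA.right.wfCtx_cons hB)
  | id A a b =>
    simp only [HTT.nfTy, Option.bind_eq_some_iff, Option.ite_none_right_eq_some,
      Option.some.injEq, Prod.exists] at h
    obtain ⟨A', hA, a', A₁, ha, hA₁, b', A₂, hb, hA₂, rfl⟩ := h
    obtain rfl := beq_sound hA₁
    obtain rfl := beq_sound hA₂
    exact .id (ih.nfTy hΓ hA) (ih.nf hΓ ha).toTmEq (ih.nf hΓ hb).toTmEq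
  | _ =>
    simp only [HTT.nfTy, Option.bind_eq_some_iff, Option.ite_none_right_eq_some,
      Option.some.injEq, Prod.exists] at h
    obtain ⟨A', S, hA, hS, rfl⟩ := h
    obtain rfl := beq_sound hS
    exact (ih.nf hΓ hA).toTmEq.toTyEq

theorem Sound.nf_lam (ih : Sound n) {A b t' T : Tm} (hΓ : WfCtx Γ)
    (h : HTT.nf (n + 1) Γ (.lam A b) = some (t', T)) : Nf Γ (.lam A b) t' T := by
  simp only [HTT.nf, Option.bind_eq_some_iff, Prod.exists] at h
  obtain ⟨A', hA, b', B, hb, h⟩ := h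
  have hA := ih.nfTy hΓ hA
  have hb := ih.nf hA.right.wfCtx_cons hb
  have hl := TmEq.lam hA hb.toTmEq
  have plain : Nf Γ (.lam A b) (.lam A' b') (.pi A' B) := ⟨hl, B, rfl, hb.right⟩
  split at h
  · rename_i f
    split at h
    · rename_i hf
      simp only [Option.bind_eq_some_iff, Option.ite_none_right_eq_some, Option.some.injEq,
        Prod.exists, Prod.mk.injEq] at h
      obtain ⟨g, T, hg, hT, rfl, rfl⟩ := h
      obtain rfl := beq_sound hT
      have hg := ih.nf hΓ hg
      have e := beq_sound hf
      have hr := hl.right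
      rw [← e] at hl hr
      exact ⟨hl.trans ((TmEq.eta hl.type hg.left hr).trans hg.toTmEq), hg.val⟩
    · cases h
      exact plain
  · cases h
    exact plain

theorem Sound.nf_app (ih : Sound n) {f a t' T : Tm} (hΓ : WfCtx Γ)
    (h : HTT.nf (n + 1) Γ (.app f a) = some (t', T)) : Nf Γ (.app f a) t' T := by
  simp only [HTT.nf, Option.bind_eq_some_iff, Prod.exists] at h
  obtain ⟨f', F, hf, h⟩ := h
  have hf := ih.nf hΓ hf
  split at h
  · rename_i A B
    simp only [Option.bind_eq_some_iff, Option.ite_none_right_eq_some, Prod.exists] at h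
    obtain ⟨a', A₁, ha, hA₁, h⟩ := h
    obtain rfl := beq_sound hA₁
    have ha := ih.nf hΓ ha
    have happ := hf.toTmEq.app ha.toTmEq
    split at h
    · rename_i A' b
      obtain ⟨B', e, hb⟩ := hf.val
      cases e
      exact ih.red (happ.trans (.beta hf.type.gen hb ha.right)) h
    · simp only [Option.map_eq_some_iff, Prod.mk.injEq] at h
      obtain ⟨T, hT, rfl, rfl⟩ := h
      exact ⟨happ.conv (ih.nfK happ.type hT), trivial⟩
  · cases h

theorem Sound.nf_pair (ih : Sound n) {B a b t' T : Tm} (hΓ : WfCtx Γ)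
    (h : HTT.nf (n + 1) Γ (.pair B a b) = some (t', T)) : Nf Γ (.pair B a b) t' T := by
  simp only [HTT.nf, Option.bind_eq_some_iff, Prod.exists, Option.some.injEq,
    Prod.mk.injEq] at h
  obtain ⟨a', A, ha, B', hB, b', S, hb, rfl, rfl⟩ := h
  have ha := ih.nf hΓ ha
  have hB := ih.nfTy ha.type.wfCtx_cons hB
  have hb := ih.chk_tmEq (hB.right.inst ha.right) hb
  exact ⟨ha.toTmEq.pair hB hb, A, rfl, ha.right, hb.right⟩

theorem Sound.nf_split (ih : Sound n) {E e c t' T : Tm} (hΓ : WfCtx Γ)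
    (h : HTT.nf (n + 1) Γ (.split E e c) = some (t', T)) : Nf Γ (.split E e c) t' T := by
  simp only [HTT.nf, Option.bind_eq_some_iff, Prod.exists] at h
  obtain ⟨c', F, hc, h⟩ := h
  have hc := ih.nf hΓ hc
  split at h
  · rename_i A B _
    simp only [Option.bind_eq_some_iff, Prod.exists] at h
    obtain ⟨E', hE, e', S, he, h⟩ := h
    have hB : Der (A :: Γ) (isType B) := hc.type.gen
    have hE := ih.nfTy hc.type.wfCtx_cons hE
    have he := ih.chk_tmEq (.subst (.ctx_cons hB) (TypedSub.splitCase hB) hE.right) he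
    have hs := TmEq.split hE he hc.toTmEq
    split at h
    · rename_i B' a b
      obtain ⟨A', eq, ha, hb⟩ := hc.val
      cases eq
      exact ih.red (hs.trans (.split_pair hE.right he.right ha hb)) h
    · simp only [Option.map_eq_some_iff, Prod.mk.injEq] at h
      obtain ⟨T, hT, rfl, rfl⟩ := h
      exact ⟨hs.conv (ih.nfK hs.type hT), trivial⟩
  · cases h

theorem Sound.nf_J (ih : Sound n) {E e a b p t' T : Tm} (hΓ : WfCtx Γ)
    (h : HTT.nf (n + 1) Γ (.J E e a b p) = some (t', T)) : Nf Γ (.J E e a b p) t' T := by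
  simp only [HTT.nf, Option.bind_eq_some_iff, Prod.exists] at h
  obtain ⟨p', F, hp, h⟩ := h
  have hp := ih.nf hΓ hp
  split at h
  · rename_i A a₁ b₁
    simp only [Option.bind_eq_some_iff, Option.ite_none_right_eq_some, Prod.exists,
      Bool.and_eq_true] at h
    obtain ⟨a', A₁, ha, ⟨hA₁, ha₁⟩, b', A₂, hb, ⟨hA₂, hb₁⟩, E', hE, e', S, he, T', hT', hc, h⟩ := h
    obtain rfl := beq_sound hA₁
    obtain rfl := beq_sound hA₂
    obtain rfl := beq_sound ha₁
    obtain rfl := beq_sound hb₁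
    have ha := (ih.nf hΓ ha).toTmEq
    have hb := (ih.nf hΓ hb).toTmEq
    have hE := ih.nfTy (wfCtx_JCtx ha.type) hE
    have he := ih.chk_tmEq (.subst (.ctx_cons ha.type) (TypedSub.JCase ha.type) hE.right) he
    have hp₀ := hp.toTmEq.conv (TyEq.id (.refl ha.type) ha hb).symm
    have hT' := ih.nfK (.subst hΓ.ctx (TypedSub.inst3 ha.right hb.right hp.right) hE.right) hT'
    have hT : TyEq Γ (E'.inst3 a b p) T' := by
      rw [Bool.or_eq_true] at hc
      rcases hc with hc | hc
      · simp only [Bool.and_eq_true] at hc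
        obtain ⟨h₁, h₂, h₃⟩ := hc
        obtain rfl := beq_sound h₁
        obtain rfl := beq_sound h₂
        obtain rfl := beq_sound h₃
        exact hT'
      · cases hS : HTT.nfK n Γ (E'.inst3 a b p) with
        | none => simp [hS] at hc
        | some S =>
          rw [hS] at hc
          obtain rfl := beq_sound hc
          exact ih.nfK (.subst hΓ.ctx (TypedSub.inst3 ha.left hb.left hp₀.left) hE.right) hS
    have hJ := TmEq.J hE he ha hb hp.toTmEq hT hT'
    split at h
    · obtain ⟨A', eq, hr⟩ := hp.val
      cases eq
      exact ih.red (hJ.trans ((TmEq.J_refl hE.right he.right hr).conv hT')) h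
    · cases h
      exact ⟨hJ, trivial⟩
  · cases h

theorem Sound.nf_funext (ih : Sound n) {f g α t' T : Tm} (hΓ : WfCtx Γ)
    (h : HTT.nf (n + 1) Γ (.funext f g α) = some (t', T)) : Nf Γ (.funext f g α) t' T := by
  simp only [HTT.nf, Option.bind_eq_some_iff, Prod.exists] at h
  obtain ⟨f', F, hf, h⟩ := h
  have hf := ih.nf hΓ hf
  split at h
  · rename_i A B _
    simp only [Option.bind_eq_some_iff, Option.ite_none_right_eq_some, Prod.exists,
      Option.some.injEq, Prod.mk.injEq] at h
    obtain ⟨g', G, hg, hG, α', S, hα, rfl, rfl⟩ := h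
    obtain rfl := beq_sound hG
    have hg := ih.nf hΓ hg
    have hB : Der (A :: Γ) (isType B) := hf.type.gen
    have hα := ih.chk_tmEq (.id_form hB hf.app_wk.right hg.app_wk.right) hα
    exact ⟨.funext hf.toTmEq hg.toTmEq hα, trivial⟩
  · cases h

theorem Sound.nf_succ (ih : Sound n) {t t' T : Tm} (hΓ : WfCtx Γ)
    (h : HTT.nf (n + 1) Γ t = some (t', T)) : Nf Γ t t' T := by
  cases t with
  | var i =>
    simp only [HTT.nf, Option.map_eq_some_iff, Prod.mk.injEq] at h
    obtain ⟨T, hT, rfl, rfl⟩ := h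
    have hT := lookup_sound hT
    exact ⟨.refl (hΓ.isType_of_lookup hT) (.var hΓ.ctx hT), trivial⟩
  | U => simp [HTT.nf] at h
  | pi A B =>
    simp only [HTT.nf, Option.bind_eq_some_iff, Option.ite_none_right_eq_some,
      Option.some.injEq, Prod.exists, Prod.mk.injEq] at h
    obtain ⟨A', S, hA, hS, B', S', hB, hS', rfl, rfl⟩ := h
    obtain rfl := beq_sound hS
    obtain rfl := beq_sound hS'
    have hA := (ih.nf hΓ hA).toTmEq
    exact ⟨hA.pi (ih.nf hA.toTyEq.right.wfCtx_cons hB).toTmEq, trivial⟩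
  | sigma A B =>
    simp only [HTT.nf, Option.bind_eq_some_iff, Option.ite_none_right_eq_some,
      Option.some.injEq, Prod.exists, Prod.mk.injEq] at h
    obtain ⟨A', S, hA, hS, B', S', hB, hS', rfl, rfl⟩ := h
    obtain rfl := beq_sound hS
    obtain rfl := beq_sound hS'
    have hA := (ih.nf hΓ hA).toTmEq
    exact ⟨hA.sigma (ih.nf hA.toTyEq.right.wfCtx_cons hB).toTmEq, trivial⟩
  | id A a b =>
    simp only [HTT.nf, Option.bind_eq_some_iff, Option.ite_none_right_eq_some,
      Option.some.injEq, Prod.exists, Prod.mk.injEq] at h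
    obtain ⟨A', S, hA, hS, a', A₁, ha, hA₁, b', A₂, hb, hA₂, rfl, rfl⟩ := h
    obtain rfl := beq_sound hS
    obtain rfl := beq_sound hA₁
    obtain rfl := beq_sound hA₂
    exact ⟨(ih.nf hΓ hA).toTmEq.id (ih.nf hΓ ha).toTmEq (ih.nf hΓ hb).toTmEq, trivial⟩
  | refl a =>
    simp only [HTT.nf, Option.map_eq_some_iff, Prod.exists, Prod.mk.injEq] at h
    obtain ⟨a', A, ha, rfl, rfl⟩ := h
    have ha := ih.nf hΓ ha
    exact ⟨ha.toTmEq.reflTm, A, rfl, ha.right⟩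
  | lam A b => exact ih.nf_lam hΓ h
  | app f a => exact ih.nf_app hΓ h
  | pair B a b => exact ih.nf_pair hΓ h
  | split E e c => exact ih.nf_split hΓ h
  | J E e a b p => exact ih.nf_J hΓ h
  | funext f g α => exact ih.nf_funext hΓ h

end

theorem sound : ∀ n, Sound n
  | 0 => by constructor <;> intros <;> simp_all [HTT.nf, HTT.nfTy, HTT.chk, HTT.nfK, HTT.red]
  | n + 1 => by
    have ih := sound n
    refine ⟨ih.nf_succ, ih.nfTy_succ, ?_, ?_, ?_⟩
    · intro Γ t S t' T hS h
      simp only [HTT.chk, Option.bind_eq_some_iff, Option.ite_none_right_eq_some, Prod.exists,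
        Option.some.injEq, Prod.mk.injEq] at h
      obtain ⟨t', T, ht, S', hS', e, rfl, rfl⟩ := h
      obtain rfl := beq_sound e
      exact ⟨ih.nfK hS hS', ih.nf hS.wfCtx ht⟩
    · intro Γ S S' hS h
      simp only [HTT.nfK] at h
      split at h
      · cases h
        exact .refl hS
      · exact ih.nfTy hS.wfCtx h
    · intro Γ t u S t' T htu h
      simp only [HTT.red] at h
      split at h
      · rename_i hu
        simp only [Bool.and_eq_true, Bool.not_eq_true'] at hu
        simp only [Option.map_eq_some_iff, Prod.mk.injEq] at h
        obtain ⟨T, hT, rfl, rfl⟩ := h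
        exact ⟨htu.conv (ih.nfK htu.type hT), .of_isIntro_eq_false hu.2⟩
      · obtain ⟨hT, h⟩ := ih.chk htu.type h
        exact .of_red htu hT h

theorem nfCtx_sound {n : ℕ} : ∀ {Γ Γ' : Ctx}, nfCtx n Γ = some Γ' →
    WfCtx Γ' ∧ WfCtx Γ ∧ TypedSub Γ Γ' Tm.var
  | [], _, h => by cases h; exact ⟨trivial, trivial, nofun⟩
  | A :: Γ, _, h => by
    simp only [nfCtx, Option.bind_eq_some_iff, Option.map_eq_some_iff] at h
    obtain ⟨Γ', hΓ, A', hA, rfl⟩ := h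
    obtain ⟨wf', wf, hσ⟩ := nfCtx_sound hΓ
    have hA' := (sound n).nfTy wf' hA
    have hA := hA'.sub wf.ctx hσ
    rw [Tm.sub_var, Tm.sub_var] at hA
    refine ⟨hA'.right.wfCtx_cons, hA.left.wfCtx_cons, ?_⟩
    rintro _ _ (_ | hi)
    · rw [Tm.sub_var]
      exact .conv (.var (.ctx_cons hA.left) .here) (.weaken hA.left hA.eq)
    · have := Der.weaken hA.left (hσ _ _ hi)
      rw [Tm.sub_var] at this ⊢
      exact this

/-- `T` is inhabited in the context `Γ`. -/
def Inh (Γ : Ctx) (T : Tm) : Prop := ∃ t, Der Γ (hasType t T)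

theorem inh_of_check {n : ℕ} {Γ : Ctx} {t T : Tm} (h : check n Γ t T = true) : Inh Γ T := by
  rw [check] at h
  cases hΓ : nfCtx n Γ with
  | none => simp [hΓ] at h
  | some Γ' =>
    obtain ⟨wf', wf, hσ⟩ := nfCtx_sound hΓ
    cases hT : nfTy n Γ' T with
    | none => simp [hΓ, hT] at h
    | some T' =>
      simp only [hΓ, hT, Option.elim_some, Option.isSome_iff_exists] at h
      obtain ⟨r, h⟩ := h
      have hT := (sound n).nfTy wf' hT
      have := Der.subst wf.ctx hσ
        (.conv ((sound n).chk_tmEq hT.right h).left (.eqType_symm hT.eq))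
      rw [Judgement.sub_var] at this
      exact ⟨t, this⟩

/-! ### Discharging hypotheses -/

/-- The context `Γ` extended by declarations of the types `Ts`, which live over a context of which
`Γ` is an extension by `k` variables; none of them depends on the variables so declared. -/
def extend (Γ : Ctx) (k : ℕ) : List Tm → Ctx
  | [] => Γ
  | T :: Ts => extend (T.wkn k :: Γ) (k + 1) Ts

theorem wkn_sub (t : Tm) (k : ℕ) (σ : ℕ → Tm) : (t.wkn k).sub σ = t.sub fun i => σ (i + k) :=
  sub_ren _ _ _

/-- Cut: inhabited hypotheses can be substituted away. -/
theorem Inh.of_extend {Γ : Ctx} {S : Tm} (hΓ : Der Γ ctx) :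
    ∀ {Ts : List Tm} {k : ℕ} {Δ : Ctx} {σ : ℕ → Tm}, TypedSub Γ Δ σ →
      (∀ T ∈ Ts, Inh Γ (T.sub fun i => σ (i + k))) →
      Inh (extend Δ k Ts) (S.wkn (k + Ts.length)) → Inh Γ (S.sub fun i => σ (i + k))
  | [], k, Δ, σ, hσ, _, ⟨t, h⟩ => by
    have := Der.subst hΓ hσ h
    rw [Judgement.sub, wkn_sub] at this
    exact ⟨_, this⟩
  | T :: Ts, k, Δ, σ, hσ, hTs, h => by
    obtain ⟨t, ht⟩ := hTs T List.mem_cons_self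
    rw [← wkn_sub] at ht
    refine Inh.of_extend (Ts := Ts) (k := k + 1) hΓ (hσ.cons ht)
      (fun T' h' => hTs T' (List.mem_cons_of_mem _ h')) ?_
    rwa [List.length_cons, Nat.add_comm Ts.length, ← Nat.add_assoc] at h

/-! ### Expressions with binders as functions -/

/-- An expression that can be placed under any number of binders: its value at `n` is its de Bruijn
form in a context with `n` variables. With this encoding a binder takes a Lean function as its body,
and weakening is implicit. The constructors of `Tm` and the derived notions are repeated for this
encoding under their names. -/
abbrev Exp : Type := ℕ → Tm

namespace Exp

/-- The variable declared as number `k`, counted from the outermost one. -/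
def v (k : ℕ) : Exp := fun n => .var (n - (k + 1))

/-- The body of a binder, in which the bound variable is number `n` if `n` variables are
declared outside. -/
def bind (b : Exp → Exp) : Exp := fun n => b (v n) (n + 1)

def U : Exp := fun _ => .U

def pi (A : Exp) (B : Exp → Exp) : Exp := fun n => .pi (A n) (bind B n)

def sigma (A : Exp) (B : Exp → Exp) : Exp := fun n => .sigma (A n) (bind B n)

def id (A a b : Exp) : Exp := fun n => .id (A n) (a n) (b n)

def lam (A : Exp) (b : Exp → Exp) : Exp := fun n => .lam (A n) (bind b n)

def app (f a : Exp) : Exp := fun n => .app (f n) (a n)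

def pair (B : Exp → Exp) (a b : Exp) : Exp := fun n => .pair (bind B n) (a n) (b n)

def split (E : Exp → Exp) (e : Exp → Exp → Exp) (c : Exp) : Exp :=
  fun n => .split (bind E n) (bind (fun x => bind fun y => e x y) n) (c n)

def refl (a : Exp) : Exp := fun n => .refl (a n)

def J (E : Exp → Exp → Exp → Exp) (e : Exp → Exp) (a b p : Exp) : Exp :=
  fun n => .J (bind (fun x => bind fun y => bind fun u => E x y u) n) (bind e n) (a n) (b n) (p n)

def funext (f g : Exp) (α : Exp → Exp) : Exp := fun n => .funext (f n) (g n) (bind α n)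

infixl:70 " ⬝ " => app

def arr (A B : Exp) : Exp := pi A fun _ => B

infixr:60 " ⇒ " => arr

def prod (A B : Exp) : Exp := sigma A fun _ => B

def fst (A c : Exp) : Exp := fun n => .fst (A n) (c n)

def idfun (A : Exp) : Exp := lam A fun x => x

def comp (A g f : Exp) : Exp := lam A fun x => g ⬝ (f ⬝ x)

/-- The family `x ↦ (Π y : X) Id_X(x, y)`, whose `Σ`-type is `iscontr(X)`. -/
def contrFam (X : Exp) : Exp → Exp := fun x => pi X fun y => id X x y

def iscontr (X : Exp) : Exp := sigma X (contrFam X)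

def hfiberFam (Y f y : Exp) : Exp → Exp := fun x => id Y (f ⬝ x) y

def isequiv (X Y f : Exp) : Exp := fun n => .isequiv (X n) (Y n) (f n)

def idIsEquiv (X : Exp) : Exp := fun n => .idIsEquiv (X n)

def extU (X Y : Exp) : Exp := fun n => .extU (X n) (Y n)

def univalence : Exp := fun _ => .univalence

/-! ### Paths -/

/-- The transport of `u : P(a)` to `P(b)` along `p : Id(a, b)`. -/
def transport (P : Exp → Exp) (a b p u : Exp) : Exp :=
  J (fun x y _ => P x ⇒ P y) (fun x => lam (P x) fun w => w) a b p ⬝ u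

/-- `p⁻¹ : Id_A(b, a)` for `p : Id_A(a, b)`. -/
def symm (A a b p : Exp) : Exp := J (fun x y _ => id A y x) (fun x => refl x) a b p

/-- `p · q : Id_A(a, c)` for `p : Id_A(a, b)`, `q : Id_A(b, c)`; `refl(b) · q` is judgementally
equal to `q`. -/
def trans (A a b c p q : Exp) : Exp :=
  J (fun x y _ => id A y c ⇒ id A x c) (fun x => lam (id A x c) fun w => w) a b p ⬝ q

/-- The path `Id_B(f(a), f(b))` induced by `p : Id(a, b)`. -/
def ap (B : Exp) (f : Exp → Exp) (a b p : Exp) : Exp :=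
  J (fun x y _ => id B (f x) (f y)) (fun x => refl (f x)) a b p

/-- `p⁻¹ · p` is equal to `refl(b)`. -/
def symmTrans (A a b p : Exp) : Exp :=
  J (fun x y r => id (id A y y) (trans A y x y (symm A x y r) r) (refl y))
    (fun x => refl (refl x)) a b p

/-! ### Contractible types and equivalences -/

/-- Paths in a small contractible type with the same end points are equal. -/
def ContrSet : Exp :=
  pi U fun X => pi X fun a => contrFam X a ⇒
    pi X fun x => pi X fun y => pi (id X x y) fun u => pi (id X x y) fun w => id (id X x y) u w

/-- If `p` contracts `X` to `a`, every path from `x` to `y` is equal to `p(x)⁻¹ · p(y)`. -/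
def contrSet : Exp :=
  lam U fun X => lam X fun a => lam (contrFam X a) fun p =>
    lam X fun x => lam X fun y => lam (id X x y) fun u => lam (id X x y) fun w =>
      let k (x y : Exp) := trans X x a y (symm X a x (p ⬝ x)) (p ⬝ y)
      let s (u : Exp) := J (fun x y u => id (id X x y) (k x y) u)
        (fun x => symmTrans X a x (p ⬝ x)) x y u
      trans (id X x y) u (k x y) w (symm (id X x y) (k x y) u (s u)) (s w)

/-- Contractibility of a small type is a proposition. -/
def ContrProp : Exp :=
  pi U fun X => pi (iscontr X) fun c => pi (iscontr X) fun d => id (iscontr X) c d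

/-- By `Id`-elimination on a path between the centres, one may assume that they coincide. The
contractions are then pointwise equal by `ContrSet`. -/
def contrProp (contrSet : Exp) : Exp :=
  lam U fun X => lam (iscontr X) fun c => lam (iscontr X) fun d =>
    split (fun z => id (iscontr X) z d)
      (fun a p => split (fun w => id (iscontr X) (pair (contrFam X) a p) w)
        (fun b q =>
          J (fun x y _ => pi (contrFam X x) fun p => pi (contrFam X y) fun q =>
              id (iscontr X) (pair (contrFam X) x p) (pair (contrFam X) y q))
            (fun x => lam (contrFam X x) fun p => lam (contrFam X x) fun q =>
              ap (iscontr X) (fun r => pair (contrFam X) x r) p q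
                (funext p q fun y => contrSet ⬝ X ⬝ x ⬝ p ⬝ x ⬝ y ⬝ (p ⬝ y) ⬝ (q ⬝ y)))
            a b (p ⬝ b) ⬝ p ⬝ q)
        d) c

/-- A retract of a contractible small type is contractible. -/
def ContrRetract : Exp :=
  pi U fun X => pi U fun Y => pi (X ⇒ Y) fun r => pi (Y ⇒ X) fun s =>
    (pi Y fun y => id Y (r ⬝ (s ⬝ y)) y) ⇒ iscontr X ⇒ iscontr Y

def contrRetract : Exp :=
  lam U fun X => lam U fun Y => lam (X ⇒ Y) fun r => lam (Y ⇒ X) fun s =>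
    lam (pi Y fun y => id Y (r ⬝ (s ⬝ y)) y) fun h => lam (iscontr X) fun c =>
      split (fun _ => iscontr Y)
        (fun a p => pair (contrFam Y) (r ⬝ a) (lam Y fun y =>
          trans Y (r ⬝ a) (r ⬝ (s ⬝ y)) y (ap Y (fun x => r ⬝ x) a (s ⬝ y) (p ⬝ (s ⬝ y))) (h ⬝ y)))
        c

/-- A function between small types that has a two-sided inverse is an equivalence. -/
def EquivOfInv : Exp :=
  pi U fun X => pi U fun Y => pi (X ⇒ Y) fun f => pi (Y ⇒ X) fun g =>
    id (X ⇒ X) (comp X g f) (idfun X) ⇒ id (Y ⇒ Y) (comp Y f g) (idfun Y) ⇒ isequiv X Y f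

/-- The fibre of `f` over `y` is a retract of the fibre of `f ∘ g` over `y`, by the maps
`(x, p) ↦ (f(x), f(η(x)) · p)` and `(z, q) ↦ (g(z), q)`; the latter fibre is contractible since
`f ∘ g` is equal to the identity. -/
def equivOfInv (contrRetract : Exp) : Exp :=
  lam U fun X => lam U fun Y => lam (X ⇒ Y) fun f => lam (Y ⇒ X) fun g =>
    lam (id (X ⇒ X) (comp X g f) (idfun X)) fun η =>
    lam (id (Y ⇒ Y) (comp Y f g) (idfun Y)) fun ε =>
    lam Y fun y =>
      let F := hfiberFam Y f y
      let G := hfiberFam Y (comp Y f g) y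
      let ηx (x : Exp) := ap X (fun φ => φ ⬝ x) (comp X g f) (idfun X) η
      let path (x x' h p : Exp) := trans Y (f ⬝ x') (f ⬝ x) y (ap Y (fun z => f ⬝ z) x' x h) p
      let r (w : Exp) := split (fun _ => sigma X F) (fun z q => pair F (g ⬝ z) q) w
      let s (w : Exp) := split (fun _ => sigma Y G)
        (fun x p => pair G (f ⬝ x) (path x (g ⬝ (f ⬝ x)) (ηx x) p)) w
      contrRetract ⬝ sigma Y G ⬝ sigma X F ⬝ lam (sigma Y G) r ⬝ lam (sigma X F) s
        ⬝ (lam (sigma X F) fun w => split (fun w => id (sigma X F) (r (s w)) w)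
            (fun x p =>
              -- `(x', f(h) · p)` is equal to `(x, p)` for every `h : Id(x', x)`
              J (fun x' x h => pi (id Y (f ⬝ x) y) fun p =>
                  id (sigma X F) (pair F x' (path x x' h p)) (pair F x p))
                (fun x => lam (id Y (f ⬝ x) y) fun p => refl (pair F x p))
                (g ⬝ (f ⬝ x)) x (ηx x) ⬝ p) w)
        ⬝ transport (fun φ => iscontr (sigma Y (hfiberFam Y φ y))) (idfun Y) (comp Y f g)
            (symm (Y ⇒ Y) (comp Y f g) (idfun Y) ε) (idIsEquiv Y ⬝ y)

/-! ### Algebras and their morphisms -/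

/-- The parameter `A : U` of the polynomial functor, the outermost variable. -/
def A : Exp := v 0

/-- The parameter `B : A → U` of the polynomial functor. -/
def B : Exp := v 1

/-- The family `x ↦ (B(x) → X)` over `x : A`. -/
def polyFam (X : Exp) : Exp → Exp := fun x => (B ⬝ x) ⇒ X

/-- The polynomial functor on types. -/
def P (X : Exp) : Exp := sigma A (polyFam X)

/-- The polynomial functor on functions `f : X → Y`. -/
def polyMap (X Y f : Exp) : Exp := fun n => .polyMap (A n) (B n) (X n) (Y n) (f n)

def algFam : Exp → Exp := fun X => P X ⇒ X

def Alg : Exp := sigma U algFam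

def AlgHom (C D : Exp) : Exp := fun n => .AlgHom (A n) (B n) (C n) (D n)

def ishinit (C : Exp) : Exp := fun n => .ishinit (A n) (B n) (C n)

/-- The type expressing that `f : X → Y` is a morphism between the algebras `(X, s)` and `(Y, t)`. -/
def isHom (X s Y t f : Exp) : Exp :=
  id (P X ⇒ Y) (comp (P X) f s) (comp (P X) t (polyMap X Y f))

/-- The type of morphisms between the algebras `(X, s)` and `(Y, t)`. -/
def Hom (X s Y t : Exp) : Exp := sigma (X ⇒ Y) fun f => isHom X s Y t f

/-- `P(1_X)` is equal to `1_{PX}`. -/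
def PolyMapId : Exp :=
  pi U fun X => id (P X ⇒ P X) (polyMap X X (idfun X)) (idfun (P X))

def polyMapId : Exp :=
  lam U fun X =>
    let F := polyMap X X (idfun X)
    funext F (idfun (P X)) fun z =>
      split (fun z => id (P X) (F ⬝ z) z) (fun x u => refl (pair (polyFam X) x u)) z

/-- `Pg ∘ Pf` is equal to `P(g ∘ f)`. -/
def PolyMapComp : Exp :=
  pi U fun X => pi U fun Y => pi U fun Z => pi (X ⇒ Y) fun f => pi (Y ⇒ Z) fun g =>
    id (P X ⇒ P Z) (comp (P X) (polyMap Y Z g) (polyMap X Y f)) (polyMap X Z (comp X g f))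

def polyMapComp : Exp :=
  lam U fun X => lam U fun Y => lam U fun Z => lam (X ⇒ Y) fun f => lam (Y ⇒ Z) fun g =>
    let F := comp (P X) (polyMap Y Z g) (polyMap X Y f)
    let G := polyMap X Z (comp X g f)
    funext F G fun z => split (fun z => id (P Z) (F ⬝ z) (G ⬝ z))
      (fun x u => refl (pair (polyFam Z) x (comp (B ⬝ x) (comp X g f) u))) z

/-- Identity functions are algebra morphisms. -/
def HomId : Exp := pi U fun X => pi (P X ⇒ X) fun s => isHom X s X s (idfun X)

def homId (polyMapId : Exp) : Exp :=
  lam U fun X => lam (P X ⇒ X) fun s =>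
    let F := polyMap X X (idfun X)
    ap (P X ⇒ X) (fun φ => comp (P X) s φ) (idfun (P X)) F
      (symm (P X ⇒ P X) F (idfun (P X)) (polyMapId ⬝ X))

/-- Algebra morphisms compose. -/
def HomComp : Exp :=
  pi U fun X => pi (P X ⇒ X) fun s => pi U fun Y => pi (P Y ⇒ Y) fun t =>
  pi U fun Z => pi (P Z ⇒ Z) fun r => pi (X ⇒ Y) fun f => pi (Y ⇒ Z) fun g =>
    isHom X s Y t f ⇒ isHom Y t Z r g ⇒ isHom X s Z r (comp X g f)

def homComp (polyMapComp : Exp) : Exp :=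
  lam U fun X => lam (P X ⇒ X) fun s => lam U fun Y => lam (P Y ⇒ Y) fun t =>
  lam U fun Z => lam (P Z ⇒ Z) fun r => lam (X ⇒ Y) fun f => lam (Y ⇒ Z) fun g =>
  lam (isHom X s Y t f) fun α => lam (isHom Y t Z r g) fun β =>
    let Pf := polyMap X Y f
    let Pg := polyMap Y Z g
    let Pgf := polyMap X Z (comp X g f)
    let e₀ := comp (P X) g (comp (P X) f s)
    let e₁ := comp (P X) g (comp (P X) t Pf)
    let e₂ := comp (P X) r (comp (P X) Pg Pf)
    let e₃ := comp (P X) r Pgf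
    trans (P X ⇒ Z) e₀ e₁ e₃
      (ap (P X ⇒ Z) (fun φ => comp (P X) g φ) (comp (P X) f s) (comp (P X) t Pf) α)
      (trans (P X ⇒ Z) e₁ e₂ e₃
        (ap (P X ⇒ Z) (fun φ => comp (P X) φ Pf) (comp (P Y) g t) (comp (P Y) r Pg) β)
        (ap (P X ⇒ Z) (fun φ => comp (P X) r φ) (comp (P X) Pg Pf) Pgf
          (polyMapComp ⬝ X ⬝ Y ⬝ Z ⬝ f ⬝ g)))

/-- If an algebra has a contractible type of endomorphisms, all of them are equal to the identity
as functions. -/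
def EndoEqId : Exp :=
  pi U fun X => pi (P X ⇒ X) fun s => iscontr (Hom X s X s) ⇒
    pi (X ⇒ X) fun h => isHom X s X s h ⇒ id (X ⇒ X) h (idfun X)

def endoEqId (homId : Exp) : Exp :=
  lam U fun X => lam (P X ⇒ X) fun s => lam (iscontr (Hom X s X s)) fun c =>
    lam (X ⇒ X) fun h => lam (isHom X s X s h) fun α =>
      let H := Hom X s X s
      let a := pair (isHom X s X s) h α
      let b := pair (isHom X s X s) (idfun X) (homId ⬝ X ⬝ s)
      split (fun _ => id (X ⇒ X) h (idfun X))
        (fun c p => ap (X ⇒ X) (fun z => fst (X ⇒ X) z) a b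
          (trans H a c b (symm H c a (p ⬝ a)) (p ⬝ b))) c

/-! ### Paths between algebras from univalence -/

/-- The type expressing that, whatever the algebra structures on `X` and `Y` for which
`f : X → Y` is a morphism, the two algebras are equal. -/
def pathOfHom (X Y f : Exp) : Exp :=
  pi (P X ⇒ X) fun s => pi (P Y ⇒ Y) fun t =>
    isHom X s Y t f ⇒ id Alg (pair algFam X s) (pair algFam Y t)

/-- Morphisms that are induced by a path between the carriers give paths between algebras. -/
def PathOfExt : Exp :=
  pi U fun X => pi U fun Y => pi (id U X Y) fun p =>
    pathOfHom X Y (fst (X ⇒ Y) (extU X Y ⬝ p))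

/-- `Id`-elimination reduces to the identity function, for which the morphism condition amounts to
equality of the structure maps. -/
def pathOfExt (polyMapId : Exp) : Exp :=
  lam U fun X => lam U fun Y => lam (id U X Y) fun p =>
    J (fun X Y p => pathOfHom X Y (fst (X ⇒ Y) (extU X Y ⬝ p)))
      (fun X => lam (P X ⇒ X) fun s => lam (P X ⇒ X) fun t =>
        lam (isHom X s X t (idfun X)) fun α =>
          let F := polyMap X X (idfun X)
          ap Alg (fun s => pair algFam X s) s t
            (trans (P X ⇒ X) s (comp (P X) t F) t α
              (ap (P X ⇒ X) (fun φ => comp (P X) t φ) F (idfun (P X)) (polyMapId ⬝ X))))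
      X Y p

/-- Morphisms whose underlying function is an equivalence give paths between algebras. -/
def PathOfEquiv : Exp :=
  pi U fun X => pi U fun Y => pi (X ⇒ Y) fun f => isequiv X Y f ⇒ pathOfHom X Y f

def pathOfEquiv (univalence pathOfExt : Exp) : Exp :=
  lam U fun X => lam U fun Y => lam (X ⇒ Y) fun f => lam (isequiv X Y f) fun w =>
    let e := pair (isequiv X Y) f w
    split (fun _ => pathOfHom X Y f)
      (fun c _ => split (fun _ => pathOfHom X Y f)
        (fun p q => transport (fun e => pathOfHom X Y (fst (X ⇒ Y) e))
          (extU X Y ⬝ p) e q (pathOfExt ⬝ X ⬝ Y ⬝ p)) c)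
      (univalence ⬝ X ⬝ Y ⬝ e)

/-! ### Homotopy-initial algebras -/

/-- Homotopy-initial algebras are equal, for algebras given as pairs. -/
def InitPathPair : Exp :=
  pi U fun X => pi (P X ⇒ X) fun s => pi U fun Y => pi (P Y ⇒ Y) fun t =>
    let C := pair algFam X s
    let D := pair algFam Y t
    ishinit C ⇒ ishinit D ⇒ id Alg C D

def initPathPair (equivOfInv homComp endoEqId pathOfEquiv : Exp) : Exp :=
  lam U fun X => lam (P X ⇒ X) fun s => lam U fun Y => lam (P Y ⇒ Y) fun t =>
    let C := pair algFam X s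
    let D := pair algFam Y t
    let T := id Alg C D
    lam (ishinit C) fun c => lam (ishinit D) fun d =>
      split (fun _ => T) (fun h _ => split (fun _ => T) (fun f α =>
        split (fun _ => T) (fun k _ => split (fun _ => T) (fun g β =>
          pathOfEquiv ⬝ X ⬝ Y ⬝ f ⬝
            (equivOfInv ⬝ X ⬝ Y ⬝ f ⬝ g
              ⬝ (endoEqId ⬝ X ⬝ s ⬝ (c ⬝ C) ⬝ comp X g f
                  ⬝ (homComp ⬝ X ⬝ s ⬝ Y ⬝ t ⬝ X ⬝ s ⬝ f ⬝ g ⬝ α ⬝ β))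
              ⬝ (endoEqId ⬝ Y ⬝ t ⬝ (d ⬝ D) ⬝ comp Y f g
                  ⬝ (homComp ⬝ Y ⬝ t ⬝ X ⬝ s ⬝ Y ⬝ t ⬝ g ⬝ f ⬝ β ⬝ α)))
            ⬝ s ⬝ t ⬝ α)
          k) (d ⬝ C)) h) (c ⬝ D)

/-- Homotopy-initial algebras are equal. -/
def InitPath : Exp :=
  pi Alg fun C => pi Alg fun D => ishinit C ⇒ ishinit D ⇒ id Alg C D

def initPath (initPathPair : Exp) : Exp :=
  lam Alg fun C => lam Alg fun D =>
    split (fun C => ishinit C ⇒ ishinit D ⇒ id Alg C D)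
      (fun X s => split (fun D => ishinit (pair algFam X s) ⇒ ishinit D ⇒
          id Alg (pair algFam X s) D)
        (fun Y t => initPathPair ⬝ X ⬝ s ⬝ Y ⬝ t) D) C

/-- Homotopy-initiality is a proposition. -/
def InitProp : Exp :=
  pi Alg fun C => pi (ishinit C) fun c => pi (ishinit C) fun d => id (ishinit C) c d

def initProp (contrProp : Exp) : Exp :=
  lam Alg fun C => lam (ishinit C) fun c => lam (ishinit C) fun d =>
    funext c d fun D => contrProp ⬝ AlgHom C D ⬝ (c ⬝ D) ⬝ (d ⬝ D)

/-- Homotopy-initial algebras are unique up to a contractible type of paths. -/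
def InitUnique : Exp := fun n => .hinitUnique (A n) (B n)

/-- The centre is `k(C, D, c, d) = s(C, C, c, c)⁻¹ · s(C, D, c, d)` with `s` the path of `InitPath`,
and `k(C, C, c, d)` is equal to `refl(C)` because `c` and `d` are equal. -/
def initUnique (initPath initProp : Exp) : Exp :=
  lam Alg fun C => lam Alg fun D => lam (prod (ishinit C) (ishinit D)) fun w =>
    let I := id Alg
    let s (C D c d : Exp) := initPath ⬝ C ⬝ D ⬝ c ⬝ d
    let k (C D c d : Exp) := trans Alg C C D (symm Alg C C (s C C c c)) (s C D c d)
    split (fun _ => iscontr (I C D))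
      (fun c d => pair (contrFam (I C D)) (k C D c d)
        (lam (I C D) fun p =>
          J (fun C D p => pi (ishinit C) fun c => pi (ishinit D) fun d =>
              id (I C D) (k C D c d) p)
            (fun C => lam (ishinit C) fun c => lam (ishinit C) fun d =>
              J (fun c d _ => id (I C C) (k C C c d) (refl C))
                (fun c => symmTrans Alg C C (s C C c c))
                c d (initProp ⬝ C ⬝ c ⬝ d))
            C D p ⬝ c ⬝ d))
      w

end Exp

/-! ### Checking the terms -/

section
open Exp

/-- The context `A : U`, `B : A → U`. -/
def paramCtx : Ctx := [(A ⇒ Exp.U) 1, Exp.U 0]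

/-- Whether `t` is confirmed to be of type `S` over the parameters `A`, `B` and the hypotheses `Ts`.
The hypotheses are the variables number `2`, `3`, … -/
def checkOver (Ts : List Exp) (t S : Exp) : Bool :=
  check 100 (extend paramCtx 0 (Ts.map fun T => T 2)) (t (2 + Ts.length)) ((S 2).wkn Ts.length)

theorem contrSet_check : checkOver [] contrSet ContrSet = true := by decide +kernel

theorem contrProp_check : checkOver [ContrSet] (contrProp (v 2)) ContrProp = true := by
  decide +kernel

theorem contrRetract_check : checkOver [] contrRetract ContrRetract = true := by decide +kernel

theorem equivOfInv_check : checkOver [ContrRetract] (equivOfInv (v 2)) EquivOfInv = true := by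
  decide +kernel

theorem polyMapId_check : checkOver [] polyMapId PolyMapId = true := by decide +kernel

theorem polyMapComp_check : checkOver [] polyMapComp PolyMapComp = true := by decide +kernel

theorem homId_check : checkOver [PolyMapId] (homId (v 2)) HomId = true := by decide +kernel

theorem homComp_check : checkOver [PolyMapComp] (homComp (v 2)) HomComp = true := by
  decide +kernel

theorem endoEqId_check : checkOver [HomId] (endoEqId (v 2)) EndoEqId = true := by decide +kernel

theorem pathOfExt_check : checkOver [PolyMapId] (pathOfExt (v 2)) PathOfExt = true := by
  decide +kernel

theorem pathOfEquiv_check :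
    checkOver [univalence, PathOfExt] (pathOfEquiv (v 2) (v 3)) PathOfEquiv = true := by
  decide +kernel

theorem initPathPair_check :
    checkOver [EquivOfInv, HomComp, EndoEqId, PathOfEquiv]
      (initPathPair (v 2) (v 3) (v 4) (v 5)) InitPathPair = true := by
  decide +kernel

theorem initPath_check : checkOver [InitPathPair] (initPath (v 2)) InitPath = true := by
  decide +kernel

theorem initProp_check : checkOver [ContrProp] (initProp (v 2)) InitProp = true := by
  decide +kernel

theorem initUnique_check :
    checkOver [InitPath, InitProp] (initUnique (v 2) (v 3)) InitUnique = true := by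
  decide +kernel

end

/-! ### Assembling the derivation -/

/-- The substitution of `A`, `B` for the parameters. -/
def param (A B : Tm) : ℕ → Tm := scons B (scons A Tm.var)

theorem TypedSub.param {Γ : Ctx} {A B : Tm} (hA : Der Γ (hasType A .U))
    (hB : Der Γ (hasType B (.arr A .U))) : TypedSub Γ paramCtx (param A B) :=
  ((TypedSub.nil Tm.var).cons hA).cons hB

/-- The type `T` over the parameters is inhabited for the values `A`, `B` of the parameters. -/
def Holds (Γ : Ctx) (A B : Tm) (T : Exp) : Prop := Inh Γ ((T 2).sub (param A B))

theorem Holds.of_check {Γ : Ctx} {A B : Tm} (hA : Der Γ (hasType A .U))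
    (hB : Der Γ (hasType B (.arr A .U))) {Ts : List Exp} {t S : Exp}
    (h : checkOver Ts t S = true) (hTs : ∀ T ∈ Ts, Holds Γ A B T) : Holds Γ A B S := by
  refine Inh.of_extend (k := 0) hA.wfCtx.ctx (.param hA hB) (Ts := Ts.map fun T => T 2) ?_ ?_
  · rintro _ hT
    obtain ⟨T, h', rfl⟩ := List.mem_map.1 hT
    exact hTs T h'
  · rw [List.length_map, Nat.zero_add]
    exact inh_of_check h

theorem hinitUnique_param (A B : Tm) : (Exp.InitUnique 2).sub (param A B) = hinitUnique A B := by
  simp [param, Exp.InitUnique, Exp.A, Exp.B, Exp.v, hinitUnique, ishinit, Tm.AlgHom, isalghom,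
    supMap, carrier, Alg, algFam, polyMap, poly, polyFam, iscontr, comp, snd, fst, prod, arr,
    Tm.sub, Tm.up, Tm.wk, wkn, ren_eq_sub, Tm.sub_sub, scons]

end HTT

open HTT in
theorem mainTheorem4 (Γ : HTT.Ctx) (A B ua : HTT.Tm)
    (hA : HTT.Der Γ (.hasType A .U))
    (hB : HTT.Der Γ (.hasType B (.arr A .U)))
    (hua : HTT.Der Γ (.hasType ua .univalence)) :
    ∃ t : HTT.Tm, HTT.Der Γ (.hasType t (.hinitUnique A B)) := by
  have univalence : Holds Γ A B Exp.univalence := ⟨ua, hua⟩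
  have contrSet := Holds.of_check hA hB contrSet_check (by simp)
  have contrProp := Holds.of_check hA hB contrProp_check (by simp [contrSet])
  have contrRetract := Holds.of_check hA hB contrRetract_check (by simp)
  have equivOfInv := Holds.of_check hA hB equivOfInv_check (by simp [contrRetract])
  have polyMapId := Holds.of_check hA hB polyMapId_check (by simp)
  have polyMapComp := Holds.of_check hA hB polyMapComp_check (by simp)
  have homId := Holds.of_check hA hB homId_check (by simp [polyMapId])
  have homComp := Holds.of_check hA hB homComp_check (by simp [polyMapComp])
  have endoEqId := Holds.of_check hA hB endoEqId_check (by simp [homId])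
  have pathOfExt := Holds.of_check hA hB pathOfExt_check (by simp [polyMapId])
  have pathOfEquiv := Holds.of_check hA hB pathOfEquiv_check (by simp [univalence, pathOfExt])
  have initPathPair := Holds.of_check hA hB initPathPair_check
    (by simp [equivOfInv, homComp, endoEqId, pathOfEquiv])
  have initPath := Holds.of_check hA hB initPath_check (by simp [initPathPair])
  have initProp := Holds.of_check hA hB initProp_check (by simp [contrProp])
  have initUnique := Holds.of_check hA hB initUnique_check (by simp [initPath, initProp])
  rwa [Holds, hinitUnique_param] at initUnique
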